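/- Setting. Let $(E,\langle\cdot,\cdot\rangle)$ and $(H,(\cdot,\cdot))$ be infinite-dimensional real Hilbert spaces with norms $\|\cdot\|$ and $|\cdot|$ and with continuous injections $E\hookrightarrow H\hookrightarrow E'$ (the second one being $h\mapsto (h,\cdot)$), the first of norm at most $1$. For $\mu>0$ let $S_\mu=\{u\in E:|u|^2=\mu\}$, $T_uS_\mu=\{v\in E:(u,v)=0\}$, $B(0,r)=\{u\in E:\|u\|<r\}$ and $B(S_\mu;0,r)=S_\mu\cap B(0,r)$. For a $C^2$ functional $\phi:E\to\mathbb R$, $\phi'|_{S_\mu}(u)$ is the restriction of $\phi'(u)$ to $T_uS_\mu$ with the dual norm from $\|\cdot\|$, and $D^2\phi(u)=\phi''(u)-\frac{\phi'(u)[u]}{|u|^2}(\cdot,\cdot)$. We say that $\phi'$ and $\phi''$ are $\alpha$-Hölder continuous on bounded sets if for every $r>0$ there is $M>0$ such that $\|\phi'(u_1)-\phi'(u_2)\|\le M\|u_1-u_2\|^\alpha$ and $\|\phi''(u_1)-\phi''(u_2)\|\le M\|u_1-u_2\|^\alpha$ (operator norms) for all $u_1,u_2\in B(0,r)$. A pseudogradient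 for $\phi$ constrained to $S_\mu$ is a map $V:S_\mu\to E$ with $V(u)\in T_uS_\mu$, locally Lipschitz on $\{u\in S_\mu:\phi'|_{S_\mu}(u)\ne0\}$, such that for some $a,b>0$ one has $\|V(u)\|\le a\|\phi'|_{S_\mu}(u)\|$ and $\phi'(u)[V(u)]\ge b\|\phi'|_{S_\mu}(u)\|^2$ for all $u\in S_\mu$. Let $\sigma$ be an isometric involution of $\mathbb R^d$. For $D\subset\mathbb R^d$ with $\sigma(D)=D$, a map $g\in C(D,S_\mu)$ is equivariant if $g\circ\sigma=-g$ on $D$. Suprema are taken in $[-\infty,+\infty]$, with $\sup\emptyset=-\infty$; $\inf\emptyset=+\infty$; the distance to or from the empty set is $+\infty$. Let $\phi$ be a $C^2$ functional on $E$ such that $\phi',\phi''$ are $\alpha$-Hölder continuous on bounded sets for some $\alpha\in(0,1]$ and $\phi|_{S_\mu}$ is even. Let $R>1$ and $0<\alpha_1\le\frac{\alpha}{2(\alpha+2)}$. Let $P^*\subset P^{**}$ be (relatively) open subsets of $S_\mu$ with $-P^*=P^*$, $-P^{**}=P^{**}$ and $$\operatorname{dist}\bigl(P^*\cap B(0,R),\;B(S_\mu;0,R)\setminus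 P^{**}\bigr)>0 .$$ Let $V$ be a pseudogradient for $\phi$ constrained to $S_\mu$ such that, for some $C_0\in(0,1]$, $C_0\|\phi'|_{S_\mu}(u)\|\le\|V(u)\|\le\|\phi'|_{S_\mu}(u)\|$ for all $u\in B(S_\mu;0,R)$. For $S\subset S_\mu$ put $S(2\xi)=\{u\in S_\mu:\operatorname{dist}(u,S)\le2\xi\}$. Call $(S,c',\epsilon,\xi)$ admissible if $S\subset S_\mu\setminus\overline{P^{**}}$, $-S=S$, $c'\in\mathbb R$, $\epsilon,\xi>0$, $S(2\xi)\subset B(S_\mu;0,R)\setminus P^*$, and $\|V(u)\|\ge2\epsilon/\xi$ for all $u\in S(2\xi)\setminus\overline{P^{**}}$ with $c'-2\epsilon\le\phi(u)\le c'+2\epsilon$. Assume: (A1) for every admissible $(S,c',\epsilon,\xi)$ there is given $\eta=\eta_{S,c',\epsilon,\xi}\in C([0,\xi]\times S_\mu,S_\mu)$ with $\eta(0,u)=u$ and $\eta(t,-u)=-\eta(t,u)$ such that (i) $\eta(t,u)=u$ for all $t\in[0,\xi]$ unless $u\in S(2\xi)$ and $c'-2\epsilon\le\phi(u)\le c'+2\epsilon$;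 (ii) $\phi(\eta(\cdot,u))$ is nonincreasing on $[0,\xi]$ for every $u\in S_\mu$; (iii) $\eta(t,u)\in\overline{P^{**}}$ for all $t\in[0,\xi]$ and $u\in\overline{P^{**}}$; (iv) for every $u\in S$ with $\phi(u)\le c'+\epsilon$, either $\eta(\xi,u)\in\overline{P^{**}}$ or $\phi(\eta(\xi,u))\le c'-\epsilon$; (A2) $\inf\{\|V(u)\|:u\in B(S_\mu;0,R)\cap\overline{P^{**}}\setminus P^*\}>0$. Let $D\subset\mathbb R^d$ be compact with $\sigma(D)=D$, and let $c\in\mathbb R$ be such that $$c\le\sup\{\phi(u):u\in\eta(\xi,g(D)),\ u\notin\overline{P^{**}}\}$$ for every equivariant $g\in C(D,S_\mu)$ and every $\eta=\eta_{S,c,\epsilon,\xi}$ as in (A1), with $(S,c,\epsilon,\xi)$ admissible. Then there is $\epsilon_0>0$ such that for every $\epsilon\in(0,\epsilon_0)$ and every equivariant $f\in C(D,S_\mu)$ with $\sup_{u\in f(D)\setminus\overline{P^{**}}}\phi(u)\le c+\epsilon$ and $$\{u\in f(D)\setminus P^{**}:\phi(u)\ge c-\epsilon\}\subset B(0,R-1),$$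 there exists $u_\epsilon\in S_\mu$ such that (1) $c-\epsilon\le\phi(u_\epsilon)\le c+\epsilon$; (2) $\|V(u_\epsilon)\|\le3\epsilon^{\alpha_1}$; (3) $u_\epsilon\in f(D)\setminus\overline{P^{**}}$; (4) if $W$ is a subspace of $T_{u_\epsilon}S_\mu$ with $D^2\phi(u_\epsilon)[w,w]<-\epsilon^{\alpha_1}\|w\|^2$ for all $w\in W\setminus\{0\}$, then $\dim W\le d$; and (1)-(4) hold for $-u_\epsilon$ in place of $u_\epsilon$ as well. -/

import Mathlib

open Set Topology

namespace ConstrainedMinimax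

section Setting

variable {E H : Type*} [NormedAddCommGroup E] [InnerProductSpace ℝ E]
  [NormedAddCommGroup H] [InnerProductSpace ℝ H]

/-- The constraint `S_μ = {u ∈ E : |u|² = μ}`, where `|·|` is the norm of `H` and `ι` is the
injection of `E` into `H`. -/
def massSphere (ι : E →L[ℝ] H) (μ : ℝ) : Set E :=
  {u | ‖ι u‖ ^ 2 = μ}

/-- The tangent space `T_u S_μ = {v ∈ E : (u, v) = 0}`, with `(·,·)` the inner product of `H`. -/
def tangentSpace (ι : E →L[ℝ] H) (u : E) : Submodule ℝ E where
  carrier := {v | inner ℝ (ι u) (ι v) = 0}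
  zero_mem' := by simp
  add_mem' := by
    intro a b ha hb
    change inner ℝ (ι u) (ι (a + b)) = 0
    change inner ℝ (ι u) (ι a) = 0 at ha
    change inner ℝ (ι u) (ι b) = 0 at hb
    rw [map_add, inner_add_right, ha, hb, add_zero]
  smul_mem' := by
    intro c a ha
    change inner ℝ (ι u) (ι (c • a)) = 0
    change inner ℝ (ι u) (ι a) = 0 at ha
    rw [map_smul, inner_smul_right, ha, mul_zero]

/-- The differential at `u` of `φ` restricted to the constraint, that is, the restriction of
`φ'(u)` to the tangent space at `u`, which carries the norm of `E`. -/
noncomputable def constrainedDeriv (ι : E →L[ℝ] H) (φ : E → ℝ) (u : E) :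
    tangentSpace ι u →L[ℝ] ℝ :=
  (fderiv ℝ φ u).comp (tangentSpace ι u).subtypeL

/-- The bilinear map `D²φ(u) = φ''(u) - (φ'(u)[u] / |u|²) (·,·)`. -/
noncomputable def constrainedHessian (ι : E →L[ℝ] H) (φ : E → ℝ) (u v w : E) : ℝ :=
  fderiv ℝ (fderiv ℝ φ) u v w - fderiv ℝ φ u u / ‖ι u‖ ^ 2 * inner ℝ (ι v) (ι w)

/-- `φ'` and `φ''` are `α`-Hölder continuous on bounded sets. -/
def HolderDerivsOnBounded (φ : E → ℝ) (α : ℝ) : Prop :=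
  ∀ r : ℝ, 0 < r → ∃ M : ℝ, 0 < M ∧ ∀ u₁ ∈ Metric.ball (0 : E) r, ∀ u₂ ∈ Metric.ball (0 : E) r,
    ‖fderiv ℝ φ u₁ - fderiv ℝ φ u₂‖ ≤ M * ‖u₁ - u₂‖ ^ α ∧
    ‖fderiv ℝ (fderiv ℝ φ) u₁ - fderiv ℝ (fderiv ℝ φ) u₂‖ ≤ M * ‖u₁ - u₂‖ ^ α

/-- `P` is an open subset of the constraint (in the relative topology) with `-P = P`. -/
structure IsSymmOpenIn (ι : E →L[ℝ] H) (μ : ℝ) (P : Set E) : Prop where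
  isOpen : ∃ U : Set E, IsOpen U ∧ P = massSphere ι μ ∩ U
  symm : ∀ u, -u ∈ P ↔ u ∈ P

/-- `V` is a pseudogradient field of `φ` constrained to `S_μ`: a tangent vector field, locally
Lipschitz off the constrained critical points, such that `‖V‖ ≤ a ‖φ'|‖` and `⟨φ', V⟩ ≥ b ‖φ'|‖²`
for some constants `a, b > 0`. Only the values of `V` on `S_μ` matter. -/
structure IsPseudogradient (ι : E →L[ℝ] H) (μ : ℝ) (φ : E → ℝ) (V : E → E) : Prop where
  tangent : ∀ u ∈ massSphere ι μ, V u ∈ tangentSpace ι u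
  locallyLipschitz :
    LocallyLipschitzOn {u | u ∈ massSphere ι μ ∧ constrainedDeriv ι φ u ≠ 0} V
  norm_le : ∃ a : ℝ, 0 < a ∧ ∀ u ∈ massSphere ι μ, ‖V u‖ ≤ a * ‖constrainedDeriv ι φ u‖
  descent : ∃ b : ℝ, 0 < b ∧ ∀ u ∈ massSphere ι μ,
    b * ‖constrainedDeriv ι φ u‖ ^ 2 ≤ fderiv ℝ φ u (V u)

/-- `S(r) = {u ∈ S_μ : dist(u, S) ≤ r}`, which is empty if `S` is. -/
def nbhd (ι : E →L[ℝ] H) (μ : ℝ) (S : Set E) (r : ℝ) : Set E :=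
  massSphere ι μ ∩ Metric.cthickening r S

/-- `{u ∈ S_μ : c - 2ε ≤ φ(u) ≤ c + 2ε}`. -/
def strip (ι : E →L[ℝ] H) (μ : ℝ) (φ : E → ℝ) (c ε : ℝ) : Set E :=
  {u | u ∈ massSphere ι μ ∧ c - 2 * ε ≤ φ u ∧ φ u ≤ c + 2 * ε}

/-- The data `S`, `c`, `ε`, `ξ` for which the flow-invariance condition provides a deformation
(`P = P*`, `Q = P**`). -/
structure IsDeformable (ι : E →L[ℝ] H) (μ : ℝ) (φ : E → ℝ) (V : E → E) (P Q : Set E) (R : ℝ)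
    (S : Set E) (c ε ξ : ℝ) : Prop where
  eps_pos : 0 < ε
  xi_pos : 0 < ξ
  subset : S ⊆ massSphere ι μ \ closure Q
  symm : ∀ u, -u ∈ S ↔ u ∈ S
  nbhd_subset : nbhd ι μ S (2 * ξ) ⊆ Metric.ball 0 R \ P
  le_norm : ∀ u ∈ strip ι μ φ c ε ∩ nbhd ι μ S (2 * ξ), u ∉ closure Q → 2 * ε / ξ ≤ ‖V u‖

/-- `η` is a deformation in `C([0,ξ] × S_μ, S_μ)`, odd in `u` and starting from the identity, with
the properties (i)-(iv) of the flow-invariance condition (`Q = P**`). Only the values of `η` on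
`[0,ξ] × S_μ` matter. -/
structure IsDeformation (ι : E →L[ℝ] H) (μ : ℝ) (φ : E → ℝ) (Q S : Set E) (c ε ξ : ℝ)
    (η : ℝ → E → E) : Prop where
  continuousOn : ContinuousOn (fun p : ℝ × E => η p.1 p.2) (Icc 0 ξ ×ˢ massSphere ι μ)
  mem : ∀ t ∈ Icc 0 ξ, ∀ u ∈ massSphere ι μ, η t u ∈ massSphere ι μ
  odd : ∀ t ∈ Icc 0 ξ, ∀ u ∈ massSphere ι μ, η t (-u) = -η t u
  zero : ∀ u ∈ massSphere ι μ, η 0 u = u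
  fixed : ∀ t ∈ Icc 0 ξ, ∀ u ∈ massSphere ι μ,
    u ∉ strip ι μ φ c ε ∩ nbhd ι μ S (2 * ξ) → η t u = u
  antitone : ∀ u ∈ massSphere ι μ, AntitoneOn (fun t => φ (η t u)) (Icc 0 ξ)
  invariant : ∀ t ∈ Icc 0 ξ, ∀ u ∈ closure Q, η t u ∈ closure Q
  descend : ∀ u ∈ S, φ u ≤ c + ε → η ξ u ∈ closure Q ∨ φ (η ξ u) ≤ c - ε

/-- Condition (A1) for `φ`, `R`, the pseudogradient `V` and the sets `P = P*`, `Q = P**`: for all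
deformable data there is a deformation. The deformation that it provides for the data `S`, `c`,
`ε`, `ξ` is named `η S c ε ξ`. -/
def FlowInvariance (ι : E →L[ℝ] H) (μ : ℝ) (φ : E → ℝ) (V : E → E) (P Q : Set E) (R : ℝ)
    (η : Set E → ℝ → ℝ → ℝ → ℝ → E → E) : Prop :=
  ∀ (S : Set E) (c ε ξ : ℝ), IsDeformable ι μ φ V P Q R S c ε ξ →
    IsDeformation ι μ φ Q S c ε ξ (η S c ε ξ)

/-- Condition (A2): the infimum of `‖V‖` over `B(S_μ;0,R) ∩ closure P** \ P*` is positive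
(`P = P*`, `Q = P**`; `closure Q ⊆ S_μ`). -/
def BoundedBelowOnCollar (V : E → E) (P Q : Set E) (R : ℝ) : Prop :=
  ∃ m : ℝ, 0 < m ∧ ∀ u ∈ (Metric.ball 0 R ∩ closure Q) \ P, m ≤ ‖V u‖

/-- `f` is (on `D`) a continuous map from `D` to `S_μ` with `f ∘ σ = -f`. -/
structure IsEquivariant (ι : E →L[ℝ] H) (μ : ℝ) {X : Type*} [TopologicalSpace X]
    (σ : X → X) (D : Set X) (f : X → E) : Prop where
  continuousOn : ContinuousOn f D
  mapsTo : MapsTo f D (massSphere ι μ)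
  equivariant : ∀ x ∈ D, f (σ x) = -f x

end Setting

end ConstrainedMinimax

/-! Argue by contradiction, with `lam = ε ^ α₁`. If no point works, every almost critical point of
`f(D)` outside `closure Q` with level in `[c - ε, c + ε]` has, at itself or at its antipode, a
subspace of dimension `d + 1` on which the constrained Hessian is below `-lam`. This turns such
points into places where `φ` can be lowered at second order, and `f` is pushed down there.

The lowering is local. The first derivative of `φ` along the map, restricted to a fixed space of
dimension `d + 1`, is a continuous map from a set in dimension `d` into dimension `d + 1`. A small
perturbation avoids zero, so there is a continuous field of unit vectors along which the derivative
is at most an arbitrarily small `τ` (`exists_unit_field_inner_le`). A step of size `δ` along this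
field, normalised back to the constraint, changes `φ` by at most `δ * τ - δ ^ 2 * lam / 4`, because
the expansion of `φ` along the constraint has the constrained Hessian as its second-order term
(`le_add_constrainedHessian`). A cutoff in the parameter and symmetrisation under `σ` make this an
equivariant step (`exists_equivariant_step`).

The steps are performed over a cover of `D` by small balls. Their radius and number depend on `f`,
but their overlap is bounded by a constant of the dimension only
(`exists_finset_cover_bounded_overlap`). Hence the total displacement is at most a constant times
`δ`, uniformly in `f`, and this is what makes `ε₀` independent of `f`. The first-order errors do add
up over all balls, but `τ` may be chosen after the cover.

The new map `g` has levels above `c - ε / 2` outside `closure Q` only near points where the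
constrained derivative exceeds `3 * lam`. The deformation of (A1) then pushes this part below `c - ε
/ 2` or into `closure Q`, against the minimax inequality. Condition (A2) and the separation of `P`
from the complement of `Q` ensure that the local steps pull no point out of `closure Q`. The bound
on `α₁` is what makes the scales `ρ`, `δ`, `ξ` compatible (`exists_scales`). -/

namespace ConstrainedMinimax

/-! ### Topological tools: nearly descending unit fields and covers of bounded overlap. -/

/-- A continuous map from a compact subset of a finite-dimensional space `X` to a space of larger
dimension has a continuous field of unit vectors along which it is almost nonpositive. -/
theorem exists_unit_field_inner_le {X F : Type*} [NormedAddCommGroup X] [NormedSpace ℝ X]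
    [FiniteDimensional ℝ X] [NormedAddCommGroup F] [InnerProductSpace ℝ F] [FiniteDimensional ℝ F]
    (hdim : Module.finrank ℝ X < Module.finrank ℝ F) {D : Set X} (hD : IsCompact D) {A : X → F}
    (hA : ContinuousOn A D) {τ : ℝ} (hτ : 0 < τ) :
    ∃ w : X → F, Continuous w ∧ (∀ x, ‖w x‖ = 1) ∧ ∀ x ∈ D, inner ℝ (A x) (w x) ≤ τ := by
  -- Tietze extension in Euclidean coordinates; smooth approximation needs a map on the whole space.
  have hext : ∃ B : X → F, Continuous B ∧ ∀ x ∈ D, B x = A x := by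
    obtain ⟨G, hG⟩ := ContinuousMap.exists_restrict_eq hD.isClosed
      ((⟨toEuclidean ∘ D.domRestrict A, toEuclidean.continuous.comp hA.domRestrict⟩ :
        C(D, EuclideanSpace ℝ (Fin (Module.finrank ℝ F)))))
    refine ⟨fun x => toEuclidean.symm (G x), toEuclidean.symm.continuous.comp G.continuous, ?_⟩
    intro x hx
    have h := congrArg (fun g => g ⟨x, hx⟩) hG
    have h2 : G x = toEuclidean (A x) := h
    simp [h2]
  obtain ⟨B, hB, hBA⟩ := hext
  obtain ⟨g, hg, hgB, -⟩ := hB.exists_contDiff_approx 1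
    (continuous_const (y := τ / 2)) (fun _ => by positivity)
  -- Sard-type step: the range of a `C¹` map into a larger dimension has dense complement, so a
  -- small translate of `g` never vanishes. The approximation and the translation each cost `τ / 2`.
  obtain ⟨p, hp, hpr⟩ := Metric.dense_iff.1 (hg.dense_compl_range_of_finrank_lt_finrank hdim)
    0 (τ / 2) (by positivity)
  have hne : ∀ x, g x - p ≠ 0 := fun x h => hpr ⟨x, sub_eq_zero.1 h⟩
  have hpos : ∀ x, 0 < ‖g x - p‖ := fun x => norm_pos_iff.2 (hne x)
  have hw1 : ∀ x, ‖-(‖g x - p‖⁻¹ • (g x - p))‖ = 1 := by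
    intro x
    rw [norm_neg, norm_smul, norm_inv, norm_norm, inv_mul_cancel₀ (hpos x).ne']
  refine ⟨fun x => -(‖g x - p‖⁻¹ • (g x - p)), ?_, hw1, ?_⟩
  · have hc : Continuous fun x => g x - p := hg.continuous.sub continuous_const
    exact ((hc.norm.inv₀ fun x => (hpos x).ne').smul hc).neg
  · intro x hx
    set w := -(‖g x - p‖⁻¹ • (g x - p)) with hw
    have h1 : inner ℝ (g x - p) w ≤ 0 := by
      rw [hw, inner_neg_right, inner_smul_right, real_inner_self_eq_norm_sq]
      have := hpos x
      simp only [Left.neg_nonpos_iff]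
      positivity
    have h2 : inner ℝ (A x - g x) w ≤ τ / 2 := by
      refine (real_inner_le_norm _ _).trans ?_
      rw [hw1 x, mul_one, ← hBA x hx, ← dist_eq_norm, dist_comm]
      exact (hgB x).le
    have h3 : inner ℝ p w ≤ τ / 2 := by
      refine (real_inner_le_norm _ _).trans ?_
      rw [hw1 x, mul_one]
      simpa using (mem_ball_zero_iff.1 hp).le
    have : A x = (A x - g x) + (g x - p) + p := by abel
    rw [this, inner_add_left, inner_add_left]
    linarith

/-- A compact set is covered by finitely many balls of radius `3h` such that the balls with the
same centres and radius `4h` have bounded overlap. -/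
theorem exists_finset_cover_bounded_overlap {X : Type*} [NormedAddCommGroup X] [NormedSpace ℝ X]
    [FiniteDimensional ℝ X] {D : Set X} (hD : IsCompact D) {h : ℝ} (hh : 0 < h) :
    ∃ Z : Finset X, (∀ x ∈ D, ∃ z ∈ Z, dist x z ≤ 3 * h) ∧
      ∀ x, ∀ Y ⊆ Z, (∀ z ∈ Y, dist x z ≤ 4 * h) → Y.card ≤ Besicovitch.multiplicity X := by
  classical
  obtain ⟨N, -, hNf, hN⟩ := hD.finite_cover_balls hh
  lift N to Finset X using hNf
  -- `Z` is a `2 * h`-separated subset of the `h`-net `N` of largest cardinality; by maximality it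
  -- is `2 * h`-dense in `N`, so `3 * h`-dense in `D`.
  obtain ⟨Z, hZ, hmax⟩ := (N.powerset.filter fun Z => ∀ a ∈ Z, ∀ b ∈ Z, a ≠ b →
    2 * h ≤ dist a b).exists_max_image Finset.card ⟨∅, by simp⟩
  rw [Finset.mem_filter, Finset.mem_powerset] at hZ
  refine ⟨Z, fun x hx => ?_, fun x Y hY hxY => ?_⟩
  · obtain ⟨y, hy, hxy⟩ := mem_iUnion₂.1 (hN hx)
    rw [Metric.mem_ball] at hxy
    suffices ∃ z ∈ Z, dist y z ≤ 2 * h by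
      obtain ⟨z, hz, hyz⟩ := this
      exact ⟨z, hz, by linarith [dist_triangle x y z]⟩
    by_contra! hcon
    have hyZ : y ∉ Z := fun hyZ => by have := hcon y hyZ; rw [dist_self] at this; linarith
    have := hmax (insert y Z) (by
      rw [Finset.mem_filter, Finset.mem_powerset]
      refine ⟨Finset.insert_subset hy hZ.1, fun a ha b hb hab => ?_⟩
      rcases Finset.mem_insert.1 ha with rfl | ha' <;> rcases Finset.mem_insert.1 hb with rfl | hb'
      · exact absurd rfl hab
      · exact (hcon b hb').le
      · rw [dist_comm]; exact (hcon a ha').le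
      · exact hZ.2 a ha' b hb' hab)
    rw [Finset.card_insert_of_notMem hyZ] at this
    omega
  -- Rescaling by `2 * h` gives 1-separated points of norm at most 2, the configuration counted by
  -- the Besicovitch multiplicity.
  · have hinj : Function.Injective fun z : X => (2 * h)⁻¹ • (z - x) := fun a b hab => by
      simpa [hh.ne'] using hab
    have hscale : ∀ v : X, ‖(2 * h)⁻¹ • v‖ = ‖v‖ / (2 * h) := fun v => by
      rw [norm_smul, Real.norm_of_nonneg (by positivity)]; ring
    rw [← Finset.card_image_of_injective Y hinj]
    refine Besicovitch.card_le_multiplicity ?_ ?_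
    · intro c hc
      obtain ⟨z, hz, rfl⟩ := Finset.mem_image.1 hc
      rw [hscale, div_le_iff₀ (by positivity), ← dist_eq_norm, dist_comm]
      linarith [hxY z hz]
    · intro a ha b hb hab
      obtain ⟨z, hz, rfl⟩ := Finset.mem_image.1 ha
      obtain ⟨y, hy, rfl⟩ := Finset.mem_image.1 hb
      rw [← smul_sub, sub_sub_sub_cancel_right, hscale, le_div_iff₀ (by positivity), one_mul,
        ← dist_eq_norm]
      exact hZ.2 z (hY hz) y (hY hy) fun h => hab (by rw [h])

/-! ### Taylor estimate and uniform derivative bounds. -/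

section SecondOrder

variable {E : Type*} [NormedAddCommGroup E] [NormedSpace ℝ E]

/-- Second-order Taylor estimate when the second derivative oscillates by at most `β`. -/
theorem le_taylor_two_of_oscillation_le {φ : E → ℝ} (hφ : ContDiff ℝ 2 φ) {u a : E} {β : ℝ}
    (hβ : ∀ t ∈ Icc (0 : ℝ) 1,
      ‖fderiv ℝ (fderiv ℝ φ) (u + t • a) - fderiv ℝ (fderiv ℝ φ) u‖ ≤ β) :
    φ (u + a) ≤ φ u + fderiv ℝ φ u a + fderiv ℝ (fderiv ℝ φ) u a a / 2 + β * ‖a‖ ^ 2 := by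
  have hβ0 : 0 ≤ β := (ContinuousLinearMap.opNorm_nonneg _).trans (hβ 0 (by simp))
  have hd1 : Differentiable ℝ φ := hφ.differentiable (by norm_num)
  have hd2 : Differentiable ℝ (fderiv ℝ φ) :=
    (hφ.fderiv_right (m := 1) (by norm_num)).differentiable (by norm_num)
  have hline : ∀ t : ℝ, HasDerivAt (fun t : ℝ => u + t • a) a t := fun t => by
    simpa using ((hasDerivAt_id t).smul_const a).const_add u
  -- The mean value inequality is used twice: here for the gradient minus its linear part, then for
  -- `φ` minus its quadratic part.
  have hgrad : ∀ t ∈ Icc (0 : ℝ) 1,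
      ‖fderiv ℝ φ (u + t • a) - fderiv ℝ φ u - t • fderiv ℝ (fderiv ℝ φ) u a‖ ≤ β * ‖a‖ := by
    intro t ht
    have hD : ∀ r : ℝ, HasDerivAt
        (fun r : ℝ => fderiv ℝ φ (u + r • a) - r • fderiv ℝ (fderiv ℝ φ) u a)
        (fderiv ℝ (fderiv ℝ φ) (u + r • a) a - fderiv ℝ (fderiv ℝ φ) u a) r := fun r => by
      have h := ((hd2 _).hasFDerivAt.comp_hasDerivAt r (hline r)).sub
        ((hasDerivAt_id r).smul_const (fderiv ℝ (fderiv ℝ φ) u a))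
      rw [one_smul] at h
      exact h
    have := norm_image_sub_le_of_norm_deriv_le_segment' (C := β * ‖a‖) (a := 0) (b := 1)
      (fun r _ => (hD r).hasDerivWithinAt) (fun r hr => by
        rw [← sub_apply]
        exact (ContinuousLinearMap.le_opNorm _ _).trans
          (mul_le_mul_of_nonneg_right (hβ r ⟨hr.1, hr.2.le⟩) (norm_nonneg _))) t ht
    simp only [zero_smul, add_zero, sub_zero] at this
    rw [sub_right_comm]
    exact this.trans (mul_le_of_le_one_right (by positivity) ht.2)
  have hD : ∀ r : ℝ, HasDerivAt
      (fun r : ℝ => φ (u + r • a) - r * fderiv ℝ φ u a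
        - r ^ 2 * (fderiv ℝ (fderiv ℝ φ) u a a / 2))
      (fderiv ℝ φ (u + r • a) a - fderiv ℝ φ u a - r * fderiv ℝ (fderiv ℝ φ) u a a) r := by
    intro r
    have h1 := (((hd1 _).hasFDerivAt.comp_hasDerivAt r (hline r)).sub
        ((hasDerivAt_id r).mul_const (fderiv ℝ φ u a))).sub
        ((hasDerivAt_pow 2 r).mul_const (fderiv ℝ (fderiv ℝ φ) u a a / 2))
    refine HasDerivAt.congr_deriv h1 ?_
    push_cast
    ring
  have := norm_image_sub_le_of_norm_deriv_le_segment' (C := β * ‖a‖ * ‖a‖) (a := 0) (b := 1)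
      (fun r _ => (hD r).hasDerivWithinAt) (fun r hr => by
        have := hgrad r ⟨hr.1, hr.2.le⟩
        exact (ContinuousLinearMap.le_opNorm
          (fderiv ℝ φ (u + r • a) - fderiv ℝ φ u - r • fderiv ℝ (fderiv ℝ φ) u a) a).trans
          (mul_le_mul_of_nonneg_right this (norm_nonneg _))) 1 (by simp)
  have h2 := (le_abs_self _).trans this
  simp only [one_smul, zero_smul, add_zero] at h2
  nlinarith [h2]

/-- On the ball of radius `R`, the number `L` bounds the first two derivatives of `φ` and their
`α`-Hölder constants. -/
structure DerivBounds (φ : E → ℝ) (α R L : ℝ) : Prop where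
  one_le : 1 ≤ L
  radius_le : R ≤ L
  norm_fderiv_le : ∀ u ∈ Metric.ball (0 : E) R, ‖fderiv ℝ φ u‖ ≤ L
  norm_fderiv_fderiv_le : ∀ u ∈ Metric.ball (0 : E) R, ‖fderiv ℝ (fderiv ℝ φ) u‖ ≤ L
  holder : ∀ u ∈ Metric.ball (0 : E) R, ∀ v ∈ Metric.ball (0 : E) R,
    ‖fderiv ℝ φ u - fderiv ℝ φ v‖ ≤ L * ‖u - v‖ ^ α
  holder_fderiv : ∀ u ∈ Metric.ball (0 : E) R, ∀ v ∈ Metric.ball (0 : E) R,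
    ‖fderiv ℝ (fderiv ℝ φ) u - fderiv ℝ (fderiv ℝ φ) v‖ ≤ L * ‖u - v‖ ^ α

/-- Hölder continuity on a ball bounds the derivatives there by their values at the origin. The
lower bound `m` will be `μ⁻¹`, so that powers of the single number `L` can serve as all constants.
-/
theorem HolderDerivsOnBounded.exists_derivBounds {E : Type*} [NormedAddCommGroup E]
    [InnerProductSpace ℝ E] {φ : E → ℝ} {α : ℝ} (hα : 0 < α)
    (h : HolderDerivsOnBounded φ α) {R : ℝ} (hR : 0 < R) (m : ℝ) :
    ∃ L, m ≤ L ∧ DerivBounds φ α R L := by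
  obtain ⟨M, hM, hMb⟩ := h R hR
  have h0 : (0 : E) ∈ Metric.ball (0 : E) R := by simpa using hR
  have hRα : 0 ≤ R ^ α := by positivity
  set L := |m| + 1 + R + M + (‖fderiv ℝ φ 0‖ + M * R ^ α)
    + (‖fderiv ℝ (fderiv ℝ φ) 0‖ + M * R ^ α) with hL
  have hMR : 0 ≤ M * R ^ α := by positivity
  have hn1 := norm_nonneg (fderiv ℝ φ 0)
  have hn2 := norm_nonneg (fderiv ℝ (fderiv ℝ φ) 0)
  have hm := abs_nonneg m
  have hML : M ≤ L := by linarith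
  have hpow : ∀ u ∈ Metric.ball (0 : E) R, M * ‖u - 0‖ ^ α ≤ M * R ^ α := fun u hu =>
    mul_le_mul_of_nonneg_left (Real.rpow_le_rpow (norm_nonneg _)
      (by simpa using (mem_ball_zero_iff.1 hu).le) hα.le) hM.le
  refine ⟨L, by linarith [le_abs_self m], by linarith, by linarith, fun u hu => ?_, fun u hu => ?_,
    fun u hu v hv => ((hMb u hu v hv).1).trans
      (mul_le_mul_of_nonneg_right hML (Real.rpow_nonneg (norm_nonneg _) _)),
    fun u hu v hv => ((hMb u hu v hv).2).trans
      (mul_le_mul_of_nonneg_right hML (Real.rpow_nonneg (norm_nonneg _) _))⟩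
  · have := norm_le_norm_add_norm_sub' (fderiv ℝ φ u) (fderiv ℝ φ 0)
    linarith [(hMb u hu 0 h0).1, hpow u hu]
  · have := norm_le_norm_add_norm_sub' (fderiv ℝ (fderiv ℝ φ) u) (fderiv ℝ (fderiv ℝ φ) 0)
    linarith [(hMb u hu 0 h0).2, hpow u hu]

end SecondOrder

/-! ### Geometry of the constraint: tangent projection and normalised steps. -/

section Sphere

variable {E H : Type*} [NormedAddCommGroup E] [InnerProductSpace ℝ E]
  [NormedAddCommGroup H] [InnerProductSpace ℝ H] {ι : E →L[ℝ] H} {μ : ℝ}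

theorem mem_massSphere {u : E} : u ∈ massSphere ι μ ↔ ‖ι u‖ ^ 2 = μ := Iff.rfl

theorem neg_mem_massSphere {u : E} : -u ∈ massSphere ι μ ↔ u ∈ massSphere ι μ := by
  simp [mem_massSphere]

theorem norm_map_le (hι : ‖ι‖ ≤ 1) (v : E) : ‖ι v‖ ≤ ‖v‖ := by
  simpa using ι.le_of_opNorm_le hι v

theorem sqrt_le_norm_of_mem_massSphere (hι : ‖ι‖ ≤ 1) {u : E} (hu : u ∈ massSphere ι μ) :
    √μ ≤ ‖u‖ := by
  rw [← mem_massSphere.1 hu, Real.sqrt_sq (norm_nonneg _)]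
  exact norm_map_le hι u

theorem abs_inner_map_le (hι : ‖ι‖ ≤ 1) (u v : E) : |inner ℝ (ι u) (ι v)| ≤ ‖u‖ * ‖v‖ :=
  (abs_real_inner_le_norm _ _).trans
    (mul_le_mul (norm_map_le hι u) (norm_map_le hι v) (norm_nonneg _) (norm_nonneg _))

theorem mem_tangentSpace {u v : E} : v ∈ tangentSpace ι u ↔ inner ℝ (ι u) (ι v) = 0 := Iff.rfl

variable (ι μ) in
/-- The projection to the tangent space of the constraint at `u`, orthogonal in `H`. -/
noncomputable def tangentProj (u w : E) : E := w - (inner ℝ (ι u) (ι w) / μ) • u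

theorem tangentProj_mem (hμ : 0 < μ) {u : E} (hu : u ∈ massSphere ι μ) (w : E) :
    tangentProj ι μ u w ∈ tangentSpace ι u := by
  rw [mem_tangentSpace, tangentProj, map_sub, map_smul, inner_sub_right, inner_smul_right,
    real_inner_self_eq_norm_sq, mem_massSphere.1 hu]
  field_simp
  ring

theorem norm_tangentProj_sub_le (hι : ‖ι‖ ≤ 1) (hμ : 0 < μ) {u v w : E}
    (hw : w ∈ tangentSpace ι v) :
    ‖tangentProj ι μ u w - w‖ ≤ ‖u - v‖ * ‖w‖ * μ⁻¹ * ‖u‖ := by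
  have h : inner ℝ (ι u) (ι w) = inner ℝ (ι (u - v)) (ι w) := by
    rw [map_sub, inner_sub_left, mem_tangentSpace.1 hw, sub_zero]
  rw [tangentProj, sub_sub_cancel_left, norm_neg, norm_smul, h, Real.norm_eq_abs, abs_div,
    abs_of_pos hμ, div_eq_mul_inv]
  gcongr
  exact abs_inner_map_le hι _ _

variable (ι μ) in
/-- The point of the constraint reached from `u` by a step of size `s` in the direction of the
tangential part of `w`, followed by normalisation. -/
noncomputable def sphereMove (u w : E) (s : ℝ) : E :=
  (√μ / ‖ι (u + s • tangentProj ι μ u w)‖) • (u + s • tangentProj ι μ u w)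

theorem norm_sq_map_add_smul {u p : E} (hu : u ∈ massSphere ι μ) (hp : p ∈ tangentSpace ι u)
    (s : ℝ) : ‖ι (u + s • p)‖ ^ 2 = μ + s ^ 2 * ‖ι p‖ ^ 2 := by
  rw [map_add, map_smul, norm_add_sq_real, inner_smul_right, mem_tangentSpace.1 hp,
    mem_massSphere.1 hu, norm_smul, mul_pow, Real.norm_eq_abs, sq_abs]
  ring

theorem norm_map_add_smul_pos (hμ : 0 < μ) {u p : E} (hu : u ∈ massSphere ι μ)
    (hp : p ∈ tangentSpace ι u) (s : ℝ) : 0 < ‖ι (u + s • p)‖ := by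
  have h := norm_sq_map_add_smul hu hp s
  have : 0 < ‖ι (u + s • p)‖ ^ 2 := by rw [h]; positivity
  exact (norm_nonneg _).lt_of_ne fun h0 => by rw [← h0] at this; norm_num at this

theorem sphereMove_mem (hμ : 0 < μ) {u : E} (hu : u ∈ massSphere ι μ) (w : E) (s : ℝ) :
    sphereMove ι μ u w s ∈ massSphere ι μ := by
  have h := norm_map_add_smul_pos hμ hu (tangentProj_mem hμ hu w) s
  rw [mem_massSphere, sphereMove, map_smul, norm_smul, norm_div, norm_norm,
    div_mul_cancel₀ _ h.ne', Real.norm_of_nonneg (Real.sqrt_nonneg _), Real.sq_sqrt hμ.le]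

theorem sphereMove_zero (hμ : 0 < μ) {u : E} (hu : u ∈ massSphere ι μ) (w : E) :
    sphereMove ι μ u w 0 = u := by
  have h : ‖ι u‖ = √μ := by rw [← mem_massSphere.1 hu, Real.sqrt_sq (norm_nonneg _)]
  rw [sphereMove, zero_smul, add_zero, h, div_self (Real.sqrt_pos.2 hμ).ne', one_smul]

theorem continuousOn_sphereMove (hμ : 0 < μ) {X : Type*} [TopologicalSpace X] {D : Set X}
    {g w : X → E} {s : X → ℝ} (hg : ContinuousOn g D) (hgm : MapsTo g D (massSphere ι μ))
    (hw : ContinuousOn w D) (hs : ContinuousOn s D) :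
    ContinuousOn (fun x => sphereMove ι μ (g x) (w x) (s x)) D := by
  have hp : ContinuousOn (fun x => g x + s x • tangentProj ι μ (g x) (w x)) D := by
    unfold tangentProj
    have h1 := ι.continuous.comp_continuousOn hg
    have h2 := ι.continuous.comp_continuousOn hw
    exact hg.add (hs.smul (hw.sub (((ContinuousOn.inner (𝕜 := ℝ) h1 h2).div_const μ).smul hg)))
  refine ContinuousOn.smul (continuousOn_const.div (ι.continuous.comp_continuousOn hp).norm ?_) hp
  exact fun x hx => (norm_map_add_smul_pos hμ (hgm hx) (tangentProj_mem hμ (hgm hx) _) _).ne'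

/-- Here `θ = (1 + t)^(-1/2)`, and the bounds are its expansion `1 - t / 2 ≤ θ ≤ 1 - t / 2 + t ^ 2 /
2`, obtained by comparing squares. -/
theorem scaling_bounds {θ t : ℝ} (hθ : 0 < θ) (ht : 0 ≤ t) (h : θ ^ 2 * (1 + t) = 1) :
    θ ≤ 1 ∧ 1 - θ ≤ t / 2 ∧ t / 2 - (1 - θ) ≤ t ^ 2 / 2 := by
  have hθ1 : θ ≤ 1 := by nlinarith [mul_nonneg (sq_nonneg θ) ht]
  refine ⟨hθ1, ?_, ?_⟩
  · by_contra! hc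
    have h1 : 0 < 1 - t / 2 := by linarith
    have h2 : θ ^ 2 < (1 - t / 2) ^ 2 := pow_lt_pow_left₀ (by linarith) hθ.le two_ne_zero
    have h3 : θ ^ 2 * (1 + t) < (1 - t / 2) ^ 2 * (1 + t) :=
      mul_lt_mul_of_pos_right h2 (by linarith)
    have h4 : (1 - t / 2) ^ 2 * (1 + t) = 1 - t ^ 2 * (3 - t) / 4 := by ring
    have : 0 ≤ t ^ 2 * (3 - t) := mul_nonneg (sq_nonneg _) (by linarith)
    linarith
  · by_contra! hc
    have h1 : 0 < 1 - t / 2 + t ^ 2 / 2 := by nlinarith [sq_nonneg (t - 1 / 2)]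
    have h2 : (1 - t / 2 + t ^ 2 / 2) ^ 2 < θ ^ 2 :=
      pow_lt_pow_left₀ (by linarith) h1.le two_ne_zero
    have h3 : (1 - t / 2 + t ^ 2 / 2) ^ 2 * (1 + t) < θ ^ 2 * (1 + t) :=
      mul_lt_mul_of_pos_right h2 (by linarith)
    have h4 : (1 - t / 2 + t ^ 2 / 2) ^ 2 * (1 + t)
        = 1 + t ^ 2 / 4 + t ^ 3 * (3 - t + t ^ 2) / 4 := by ring
    have h5 : 0 ≤ t ^ 3 * (3 - t + t ^ 2) :=
      mul_nonneg (by positivity) (by nlinarith [sq_nonneg (t - 1 / 2)])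
    nlinarith [sq_nonneg t]

/-- Pythagoras in `H`: the tangential step is orthogonal to `u`, so the normalising factor differs
from 1 only at order `s ^ 2`. -/
theorem exists_sphereMove_eq_smul (hμ : 0 < μ) {u : E} (hu : u ∈ massSphere ι μ) (w : E) (s : ℝ) :
    ∃ θ : ℝ, 0 < θ ∧ θ ^ 2 * (1 + s ^ 2 * ‖ι (tangentProj ι μ u w)‖ ^ 2 * μ⁻¹) = 1 ∧
      sphereMove ι μ u w s = θ • (u + s • tangentProj ι μ u w) := by
  have hp := tangentProj_mem hμ hu w
  have h := norm_map_add_smul_pos hμ hu hp s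
  refine ⟨_, div_pos (Real.sqrt_pos.2 hμ) h, ?_, rfl⟩
  rw [div_pow, Real.sq_sqrt hμ.le, norm_sq_map_add_smul hu hp]
  have : 0 < μ + s ^ 2 * ‖ι (tangentProj ι μ u w)‖ ^ 2 := by positivity
  field_simp

theorem norm_tangentProj_le (hι : ‖ι‖ ≤ 1) (hμ : 0 < μ) {L : ℝ} (hL : 1 ≤ L) (hμL : μ⁻¹ ≤ L)
    {u w : E} (hu : ‖u‖ ≤ L) (hw : ‖w‖ = 1) : ‖tangentProj ι μ u w‖ ≤ 2 * L ^ 3 := by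
  have h1 : |inner ℝ (ι u) (ι w)| ≤ L := by
    have := abs_inner_map_le hι u w
    rw [hw, mul_one] at this
    exact this.trans hu
  have h2 : ‖(inner ℝ (ι u) (ι w) / μ) • u‖ ≤ L * L * L := by
    rw [norm_smul, Real.norm_eq_abs, abs_div, abs_of_pos hμ, div_eq_mul_inv]
    gcongr
  have h3 : 1 ≤ L ^ 3 := one_le_pow₀ hL
  have := norm_sub_le w ((inner ℝ (ι u) (ι w) / μ) • u)
  rw [tangentProj]
  nlinarith

/-- The step of size `s` on the constraint differs from the tangential step by `O(s²)`. -/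
theorem norm_sphereMove_sub_le (hι : ‖ι‖ ≤ 1) (hμ : 0 < μ) {L : ℝ} (hL : 1 ≤ L) (hμL : μ⁻¹ ≤ L)
    {u w : E} (hum : u ∈ massSphere ι μ) (hu : ‖u‖ ≤ L) (hw : ‖w‖ = 1) {s : ℝ} (hs0 : 0 ≤ s)
    (hs1 : s ≤ 1) :
    ‖sphereMove ι μ u w s - u - s • tangentProj ι μ u w‖ ≤ 6 * L ^ 10 * s ^ 2 ∧
      ‖sphereMove ι μ u w s - u‖ ≤ 8 * L ^ 10 * s := by
  obtain ⟨θ, hθ, hθt, hmove⟩ := exists_sphereMove_eq_smul hμ hum w s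
  have hp := norm_tangentProj_le hι hμ hL hμL hu hw
  set p := tangentProj ι μ u w
  have hL0 : 0 < L := by linarith
  have ht : 0 ≤ s ^ 2 * ‖ι p‖ ^ 2 * μ⁻¹ := by positivity
  obtain ⟨h1, h2, -⟩ := scaling_bounds hθ ht hθt
  have hιp : ‖ι p‖ ≤ 2 * L ^ 3 := (norm_map_le hι p).trans hp
  have htb : s ^ 2 * ‖ι p‖ ^ 2 * μ⁻¹ ≤ s ^ 2 * (2 * L ^ 3) ^ 2 * L := by gcongr
  have hLL : L ≤ L ^ 3 := le_self_pow₀ hL (by norm_num)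
  have hsum : ‖u + s • p‖ ≤ 3 * L ^ 3 := by
    have h4 : ‖s • p‖ ≤ ‖p‖ := by
      rw [norm_smul, Real.norm_of_nonneg hs0]
      exact mul_le_of_le_one_left (norm_nonneg _) hs1
    linarith [norm_add_le u (s • p)]
  have hfirst : ‖sphereMove ι μ u w s - u - s • p‖ ≤ 6 * L ^ 10 * s ^ 2 := by
    have : sphereMove ι μ u w s - u - s • p = -((1 - θ) • (u + s • p)) := by
      rw [hmove, sub_smul, one_smul]; abel
    rw [this, norm_neg, norm_smul, Real.norm_of_nonneg (by linarith)]
    calc (1 - θ) * ‖u + s • p‖ ≤ (s ^ 2 * (2 * L ^ 3) ^ 2 * L / 2) * (3 * L ^ 3) := by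
          gcongr; linarith
      _ = 6 * L ^ 10 * s ^ 2 := by ring
  refine ⟨hfirst, ?_⟩
  have h5 : ‖s • p‖ ≤ s * (2 * L ^ 10) := by
    rw [norm_smul, Real.norm_of_nonneg hs0]
    have : L ^ 3 ≤ L ^ 10 := pow_le_pow_right₀ hL (by norm_num)
    exact mul_le_mul_of_nonneg_left (by linarith) hs0
  have h6 : 6 * L ^ 10 * s ^ 2 ≤ 6 * L ^ 10 * s := by
    have : s ^ 2 ≤ s := by nlinarith
    gcongr
  have := norm_add_le (sphereMove ι μ u w s - u - s • p) (s • p)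
  rw [sub_add_cancel] at this
  linarith

/-! ### Second-order expansion of the functional along the constraint. -/

theorem abs_bilin_diag_sub_le {B : E →L[ℝ] E →L[ℝ] ℝ} {K : ℝ} (hB : ‖B‖ ≤ K) (a b : E) :
    |B a a - B b b| ≤ K * ‖a - b‖ * (‖a‖ + ‖b‖) := by
  have h1 : B a a - B b b = B (a - b) a + B b (a - b) := by
    simp only [map_sub, sub_apply]; ring
  have h2 := B.le_opNorm₂ (a - b) a
  have h3 := B.le_opNorm₂ b (a - b)
  rw [Real.norm_eq_abs] at h2 h3
  rw [h1]
  have hK : ‖B‖ * ‖a - b‖ * ‖a‖ + ‖B‖ * ‖b‖ * ‖a - b‖ ≤ K * ‖a - b‖ * (‖a‖ + ‖b‖) := by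
    have : ‖B‖ * (‖a - b‖ * (‖a‖ + ‖b‖)) ≤ K * (‖a - b‖ * (‖a‖ + ‖b‖)) := by gcongr
    linarith
  exact (abs_add_le _ _).trans (by linarith)

/-- The term `|w|² φ'(u)[u] / μ` of the constrained Hessian varies little with `u` and `w`. -/
theorem neg_normSq_mul_fderiv_le (hμ : 0 < μ) {φ : E → ℝ} {L : ℝ} (hL : 1 ≤ L) (hμL : μ⁻¹ ≤ L)
    {u₀ u w p : E} (huL : ‖u‖ ≤ L) (hφu : |fderiv ℝ φ u u| ≤ L ^ 2)
    (hφu₀ : ‖fderiv ℝ φ u₀‖ ≤ L) {ω : ℝ} (hω0 : 0 ≤ ω) (hρ : ‖u - u₀‖ ≤ ω)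
    (hφω : ‖fderiv ℝ φ u - fderiv ℝ φ u₀‖ ≤ L * ω) (hιw : ‖ι w‖ ≤ 1) (hιp : ‖ι p‖ ≤ 2 * L ^ 3)
    (hιpw : ‖ι p - ι w‖ ≤ ω * L ^ 2) :
    -(‖ι p‖ ^ 2 * μ⁻¹ * fderiv ℝ φ u u)
      ≤ -(‖ι w‖ ^ 2 * μ⁻¹ * fderiv ℝ φ u₀ u₀) + 10 * L ^ 40 * ω := by
  have hL0 : 0 < L := by linarith
  have hpow : ∀ n m : ℕ, n ≤ m → L ^ n ≤ L ^ m := fun n m h => pow_le_pow_right₀ hL h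
  have h4 : |‖ι p‖ ^ 2 - ‖ι w‖ ^ 2| ≤ 3 * L ^ 5 * ω := by
    have h5 : |‖ι p‖ - ‖ι w‖| ≤ ω * L ^ 2 :=
      (abs_norm_sub_norm_le _ _).trans hιpw
    have h6 : ‖ι p‖ + ‖ι w‖ ≤ 3 * L ^ 3 := by linarith [one_le_pow₀ hL (n := 3)]
    rw [sq_sub_sq, abs_mul, abs_of_nonneg (a := ‖ι p‖ + ‖ι w‖) (by positivity)]
    calc _ ≤ 3 * L ^ 3 * (ω * L ^ 2) := by gcongr
      _ = 3 * L ^ 5 * ω := by ring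
  have h5 : |fderiv ℝ φ u u - fderiv ℝ φ u₀ u₀| ≤ 2 * L ^ 2 * ω := by
    have h6 : fderiv ℝ φ u u - fderiv ℝ φ u₀ u₀
        = (fderiv ℝ φ u - fderiv ℝ φ u₀) u + fderiv ℝ φ u₀ (u - u₀) := by
      rw [sub_apply, map_sub]; ring
    have h7 : |(fderiv ℝ φ u - fderiv ℝ φ u₀) u| ≤ L * ω * L := by
      rw [← Real.norm_eq_abs]
      refine (ContinuousLinearMap.le_opNorm _ _).trans ?_
      gcongr
    have h8 : |fderiv ℝ φ u₀ (u - u₀)| ≤ L * ω := by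
      rw [← Real.norm_eq_abs]
      refine (ContinuousLinearMap.le_opNorm _ _).trans ?_
      gcongr
    have h9 : L * ω ≤ L ^ 2 * ω := by gcongr; exact le_self_pow₀ hL (by norm_num)
    rw [h6]
    refine (abs_add_le _ _).trans ?_
    linarith
  have h6 : ‖ι w‖ ^ 2 * μ⁻¹ * fderiv ℝ φ u₀ u₀ - ‖ι p‖ ^ 2 * μ⁻¹ * fderiv ℝ φ u u
      = -((‖ι p‖ ^ 2 - ‖ι w‖ ^ 2) * μ⁻¹ * fderiv ℝ φ u u)
        - ‖ι w‖ ^ 2 * μ⁻¹ * (fderiv ℝ φ u u - fderiv ℝ φ u₀ u₀) := by ring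
  have h7 : |(‖ι p‖ ^ 2 - ‖ι w‖ ^ 2) * μ⁻¹ * fderiv ℝ φ u u| ≤ 3 * L ^ 5 * ω * L * L ^ 2 := by
    rw [abs_mul, abs_mul, abs_of_pos (inv_pos.2 hμ)]
    gcongr
  have h8 : |‖ι w‖ ^ 2 * μ⁻¹ * (fderiv ℝ φ u u - fderiv ℝ φ u₀ u₀)|
      ≤ 1 ^ 2 * L * (2 * L ^ 2 * ω) := by
    rw [abs_mul, abs_mul, abs_of_pos (inv_pos.2 hμ), abs_of_nonneg (sq_nonneg ‖ι w‖)]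
    gcongr
  have h9 : 3 * L ^ 5 * ω * L * L ^ 2 ≤ 3 * L ^ 40 * ω := by
    have h10 : 3 * L ^ 5 * ω * L * L ^ 2 = 3 * L ^ 8 * ω := by ring
    rw [h10]; gcongr ?_ * ?_ * _; exact hpow _ _ (by norm_num)
  have h11 : 1 ^ 2 * L * (2 * L ^ 2 * ω) ≤ 2 * L ^ 40 * ω := by
    have h10 : 1 ^ 2 * L * (2 * L ^ 2 * ω) = 2 * L ^ 3 * ω := by ring
    rw [h10]; gcongr ?_ * ?_ * _; exact hpow _ _ (by norm_num)
  have h12 : 0 ≤ L ^ 40 * ω := by positivity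
  linarith [(abs_le.1 h7).1, (abs_le.1 h8).1]

set_option maxHeartbeats 1000000 in
/-- Along a step on the constraint, in a direction `w` tangent at a nearby point `u₀`, the
functional changes by the constrained Hessian at `u₀` up to a small quadratic error. -/
theorem le_add_constrainedHessian (hι : ‖ι‖ ≤ 1) (hμ : 0 < μ) {φ : E → ℝ} (hφ : ContDiff ℝ 2 φ)
    {α R L : ℝ} (hα0 : 0 < α) (hα1 : α ≤ 1) (hb : DerivBounds φ α R L) (hμL : μ⁻¹ ≤ L)
    {u₀ u w : E} (hu₀m : u₀ ∈ massSphere ι μ) (hu₀ : u₀ ∈ Metric.ball (0 : E) R)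
    (hum : u ∈ massSphere ι μ) (hu : u ∈ Metric.ball (0 : E) R)
    (hw : w ∈ tangentSpace ι u₀) (hw1 : ‖w‖ = 1) {ρ s τ : ℝ} (hρ1 : ρ ≤ 1) (hρ : ‖u - u₀‖ ≤ ρ)
    (hs0 : 0 ≤ s) (hsρ : s ≤ ρ) (hmove : sphereMove ι μ u w s ∈ Metric.ball (0 : E) R)
    (hτ0 : 0 ≤ τ) (hτ : fderiv ℝ φ u (tangentProj ι μ u w) ≤ τ) :
    φ (sphereMove ι μ u w s) ≤ φ u + s * τ + s ^ 2 / 2 * constrainedHessian ι φ u₀ w w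
      + 1000 * L ^ 40 * s ^ 2 * ρ ^ α := by
  have hL := hb.one_le
  have hL0 : 0 < L := by linarith
  have hρ0 : 0 ≤ ρ := hs0.trans hsρ
  have hω : ρ ≤ ρ ^ α := by
    simpa using Real.rpow_le_rpow_of_exponent_ge' hρ0 hρ1 hα0.le hα1
  have hω0 : 0 ≤ ρ ^ α := by positivity
  set ω := ρ ^ α with hωdef
  have huL : ‖u‖ ≤ L := (mem_ball_zero_iff.1 hu).le.trans hb.radius_le
  have hu₀L : ‖u₀‖ ≤ L := (mem_ball_zero_iff.1 hu₀).le.trans hb.radius_le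
  obtain ⟨hq, ha⟩ := norm_sphereMove_sub_le hι hμ hL hμL hum huL hw1 hs0 (hsρ.trans hρ1)
  have hp := norm_tangentProj_le hι hμ hL hμL huL hw1
  have hpw : ‖tangentProj ι μ u w - w‖ ≤ ρ * L ^ 2 := by
    refine (norm_tangentProj_sub_le hι hμ hw).trans ?_
    rw [hw1, mul_one]
    calc ‖u - u₀‖ * μ⁻¹ * ‖u‖ ≤ ρ * L * L := by gcongr
      _ = ρ * L ^ 2 := by ring
  obtain ⟨θ, hθ, hθt, hγ⟩ := exists_sphereMove_eq_smul hμ hum w s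
  have hιw : ‖ι w‖ ≤ 1 := hw1 ▸ norm_map_le hι w
  have hιp : ‖ι (tangentProj ι μ u w)‖ ≤ 2 * L ^ 3 := (norm_map_le hι _).trans hp
  have hιpw : ‖ι (tangentProj ι μ u w) - ι w‖ ≤ ρ * L ^ 2 := by
    rw [← map_sub]; exact (norm_map_le hι _).trans hpw
  set p := tangentProj ι μ u w with hpdef
  set γ := sphereMove ι μ u w s with hγdef
  have hpow : ∀ n m : ℕ, n ≤ m → L ^ n ≤ L ^ m := fun n m h => pow_le_pow_right₀ hL h
  have hnear : ∀ v : E, ∀ k : ℝ, 1 ≤ k → ‖v‖ ≤ k * ρ → ‖v‖ ^ α ≤ k * ω := fun v k hk hv => by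
    calc ‖v‖ ^ α ≤ (k * ρ) ^ α := Real.rpow_le_rpow (norm_nonneg _) hv hα0.le
      _ = k ^ α * ω := Real.mul_rpow (by linarith) hρ0
      _ ≤ k * ω := by
        gcongr
        simpa using Real.rpow_le_rpow_of_exponent_le hk hα1
  -- Taylor expansion at `u`
  have hK : (1 : ℝ) ≤ 8 * L ^ 10 := by linarith [one_le_pow₀ hL (n := 10)]
  have htaylor := le_taylor_two_of_oscillation_le hφ (u := u) (a := γ - u)
    (β := L * (8 * L ^ 10 * ω)) (fun t ht => by
      have hmem : u + t • (γ - u) ∈ Metric.ball (0 : E) R :=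
        (convex_ball (0 : E) R).add_smul_sub_mem hu hmove ht
      refine (hb.holder_fderiv _ hmem _ hu).trans
        (mul_le_mul_of_nonneg_left (hnear _ _ hK ?_) hL0.le)
      rw [add_sub_cancel_left, norm_smul, Real.norm_of_nonneg ht.1]
      calc t * ‖γ - u‖ ≤ 1 * (8 * L ^ 10 * s) := by gcongr; exact ht.2
        _ ≤ 8 * L ^ 10 * ρ := by rw [one_mul]; gcongr)
  rw [add_sub_cancel] at htaylor
  have hrem : L * (8 * L ^ 10 * ω) * ‖γ - u‖ ^ 2 ≤ 512 * L ^ 40 * s ^ 2 * ω := by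
    calc L * (8 * L ^ 10 * ω) * ‖γ - u‖ ^ 2 ≤ L * (8 * L ^ 10 * ω) * (8 * L ^ 10 * s) ^ 2 := by
          gcongr
      _ = 512 * L ^ 31 * s ^ 2 * ω := by ring
      _ ≤ 512 * L ^ 40 * s ^ 2 * ω := by gcongr ?_ * ?_ * _ * _; exact hpow _ _ (by norm_num)
  -- the quadratic term
  have hsw : ‖s • w‖ = s := by rw [norm_smul, hw1, Real.norm_of_nonneg hs0, mul_one]
  -- Inside the quadratic form the displacement may be replaced by `s • w`: the normalisation error
  -- is `O(s²)` and the projection error `O(s * ρ)`.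
  have hdiff : ‖γ - u - s • w‖ ≤ 7 * L ^ 10 * s * ρ := by
    have h1 : γ - u - s • w = (γ - u - s • p) + s • (p - w) := by rw [smul_sub]; abel
    have h2 : ‖s • (p - w)‖ ≤ s * (ρ * L ^ 2) := by
      rw [norm_smul, Real.norm_of_nonneg hs0]; gcongr
    have h3 : 6 * L ^ 10 * s ^ 2 ≤ 6 * L ^ 10 * s * ρ := by
      rw [sq, ← mul_assoc]; gcongr
    have h4 : s * (ρ * L ^ 2) ≤ s * (ρ * L ^ 10) := by gcongr; norm_num
    rw [h1]
    linarith [norm_add_le (γ - u - s • p) (s • (p - w))]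
  have hquad1 : fderiv ℝ (fderiv ℝ φ) u (γ - u) (γ - u)
      ≤ s ^ 2 * fderiv ℝ (fderiv ℝ φ) u w w + 63 * L ^ 40 * s ^ 2 * ω := by
    have h1 := (le_abs_self _).trans
      (abs_bilin_diag_sub_le (hb.norm_fderiv_fderiv_le u hu) (γ - u) (s • w))
    have h2 : fderiv ℝ (fderiv ℝ φ) u (s • w) (s • w) = s ^ 2 * fderiv ℝ (fderiv ℝ φ) u w w := by
      simp only [map_smul, smul_apply, smul_eq_mul]; ring
    have h3 : L * ‖γ - u - s • w‖ * (‖γ - u‖ + ‖s • w‖) ≤ 63 * L ^ 40 * s ^ 2 * ω := by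
      calc L * ‖γ - u - s • w‖ * (‖γ - u‖ + ‖s • w‖)
          ≤ L * (7 * L ^ 10 * s * ω) * (8 * L ^ 10 * s + L ^ 10 * s) := by
            have h4 : ‖γ - u - s • w‖ ≤ 7 * L ^ 10 * s * ω := hdiff.trans (by gcongr)
            have h5 : ‖s • w‖ ≤ L ^ 10 * s := by
              rw [hsw]; exact le_mul_of_one_le_left hs0 (one_le_pow₀ hL)
            gcongr
        _ = 63 * L ^ 21 * s ^ 2 * ω := by ring
        _ ≤ 63 * L ^ 40 * s ^ 2 * ω := by gcongr ?_ * ?_ * _ * _; exact hpow _ _ (by norm_num)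
    linarith
  have hquad2 : fderiv ℝ (fderiv ℝ φ) u w w ≤ fderiv ℝ (fderiv ℝ φ) u₀ w w + L ^ 40 * ω := by
    have h1 := (fderiv ℝ (fderiv ℝ φ) u - fderiv ℝ (fderiv ℝ φ) u₀).le_opNorm₂ w w
    rw [hw1, mul_one, mul_one] at h1
    have h2 := (le_abs_self _).trans h1
    have h3 : (fderiv ℝ (fderiv ℝ φ) u - fderiv ℝ (fderiv ℝ φ) u₀) w w
      = fderiv ℝ (fderiv ℝ φ) u w w - fderiv ℝ (fderiv ℝ φ) u₀ w w := rfl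
    rw [h3] at h2
    have h4 := (hb.holder_fderiv u hu u₀ hu₀).trans
      (mul_le_mul_of_nonneg_left (hnear _ 1 le_rfl (by linarith)) hL0.le)
    have h5 : L * (1 * ω) ≤ L ^ 40 * ω := by
      rw [one_mul]; gcongr; exact le_self_pow₀ hL (by norm_num)
    linarith
  -- the linear term
  have ht0 : 0 ≤ s ^ 2 * ‖ι p‖ ^ 2 * μ⁻¹ := by positivity
  obtain ⟨h1, -, h3⟩ := scaling_bounds hθ ht0 hθt
  have hφu : |fderiv ℝ φ u u| ≤ L ^ 2 := by
    rw [sq, ← Real.norm_eq_abs]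
    exact (ContinuousLinearMap.le_opNorm _ _).trans
      (mul_le_mul (hb.norm_fderiv_le u hu) huL (norm_nonneg _) hL0.le)
  -- Normalisation pulls back by `(1 - θ) • u`, with `1 - θ` close to `s ^ 2 * ‖ι p‖ ^ 2 / (2 * μ)`.
  -- Paired with `φ'(u)` this yields the multiplier term of the constrained Hessian.
  have hlin1 : fderiv ℝ φ u (γ - u) ≤ s * τ - (1 - θ) * fderiv ℝ φ u u := by
    have h4 : γ - u = (θ * s) • p - (1 - θ) • u := by
      rw [hγ, smul_add, smul_smul, sub_smul, one_smul]; abel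
    rw [h4, map_sub, map_smul, map_smul, smul_eq_mul, smul_eq_mul]
    have h5 : θ * s * fderiv ℝ φ u p ≤ s * τ := by
      calc θ * s * fderiv ℝ φ u p ≤ θ * s * τ := by gcongr
        _ ≤ 1 * s * τ := by gcongr
        _ = s * τ := by ring
    linarith
  have ht1 : s ^ 2 * ‖ι p‖ ^ 2 * μ⁻¹ ≤ 4 * L ^ 7 * s ^ 2 := by
    calc s ^ 2 * ‖ι p‖ ^ 2 * μ⁻¹ ≤ s ^ 2 * (2 * L ^ 3) ^ 2 * L := by gcongr
      _ = 4 * L ^ 7 * s ^ 2 := by ring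
  have hs2 : s ^ 2 ≤ ω := by nlinarith
  have hlin2 : -((1 - θ) * fderiv ℝ φ u u)
      ≤ -(s ^ 2 * ‖ι p‖ ^ 2 * μ⁻¹ / 2 * fderiv ℝ φ u u) + 8 * L ^ 40 * s ^ 2 * ω := by
    have h4 : |s ^ 2 * ‖ι p‖ ^ 2 * μ⁻¹ / 2 - (1 - θ)| ≤ 8 * L ^ 14 * s ^ 2 * ω := by
      rw [abs_of_nonneg (by linarith [(scaling_bounds hθ ht0 hθt).2.1])]
      calc _ ≤ (s ^ 2 * ‖ι p‖ ^ 2 * μ⁻¹) ^ 2 / 2 := h3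
        _ ≤ (4 * L ^ 7 * s ^ 2) ^ 2 / 2 := by gcongr
        _ = 8 * L ^ 14 * s ^ 2 * s ^ 2 := by ring
        _ ≤ 8 * L ^ 14 * s ^ 2 * ω := by gcongr
    have h5 : (s ^ 2 * ‖ι p‖ ^ 2 * μ⁻¹ / 2 - (1 - θ)) * fderiv ℝ φ u u
        ≤ 8 * L ^ 40 * s ^ 2 * ω := by
      refine (le_abs_self _).trans ?_
      rw [abs_mul]
      calc _ ≤ 8 * L ^ 14 * s ^ 2 * ω * L ^ 2 := by gcongr
        _ = 8 * L ^ 16 * s ^ 2 * ω := by ring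
        _ ≤ 8 * L ^ 40 * s ^ 2 * ω := by gcongr ?_ * ?_ * _ * _; exact hpow _ _ (by norm_num)
    linarith
  have hφω : ‖fderiv ℝ φ u - fderiv ℝ φ u₀‖ ≤ L * ω := by
    have := (hb.holder u hu u₀ hu₀).trans
      (mul_le_mul_of_nonneg_left (hnear _ 1 le_rfl (by linarith)) hL0.le)
    rwa [one_mul] at this
  have hlin3 : -(‖ι p‖ ^ 2 * μ⁻¹ * fderiv ℝ φ u u)
      ≤ -(‖ι w‖ ^ 2 * μ⁻¹ * fderiv ℝ φ u₀ u₀) + 10 * L ^ 40 * ω := 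
    neg_normSq_mul_fderiv_le hμ hL hμL huL hφu (hb.norm_fderiv_le u₀ hu₀) hω0 (hρ.trans hω)
      hφω hιw hιp (hιpw.trans (by gcongr))
  -- assembling
  have hHess : constrainedHessian ι φ u₀ w w
      = fderiv ℝ (fderiv ℝ φ) u₀ w w - ‖ι w‖ ^ 2 * μ⁻¹ * fderiv ℝ φ u₀ u₀ := by
    rw [constrainedHessian, mem_massSphere.1 hu₀m, real_inner_self_eq_norm_sq]
    ring
  have hs20 : 0 ≤ s ^ 2 / 2 := by positivity
  have e1 := mul_le_mul_of_nonneg_left hquad2 hs20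
  have e2 := mul_le_mul_of_nonneg_left hlin3 hs20
  -- The error coefficients add up to `512 + 63/2 + 1/2 + 8 + 5`, below 1000.
  have e3 : 0 ≤ L ^ 40 * s ^ 2 * ω := by positivity
  rw [hHess]
  linarith

end Sphere

/-! ### Symmetry, and comparison of constrained derivatives at different points. -/

theorem neg_mem_closure_iff {G : Type*} [NormedAddCommGroup G] {Q : Set G}
    (hQ : ∀ u, -u ∈ Q ↔ u ∈ Q) (u : G) :
    -u ∈ closure Q ↔ u ∈ closure Q := by
  have h : (Homeomorph.neg G) ⁻¹' Q = Q := by ext u; exact hQ u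
  have h2 := (Homeomorph.neg G).preimage_closure Q
  rw [h] at h2
  exact Set.ext_iff.1 h2 u

section Sphere

variable {E H : Type*} [NormedAddCommGroup E] [InnerProductSpace ℝ E]
  [NormedAddCommGroup H] [InnerProductSpace ℝ H] {ι : E →L[ℝ] H} {μ : ℝ}

/-- The two tangent spaces differ, so a vector tangent at `u` is first projected to the tangent
space at `v`. Hölder continuity of `φ'` gives one error term and the projection gives two. -/
theorem norm_constrainedDeriv_le_add (hι : ‖ι‖ ≤ 1) (hμ : 0 < μ) {φ : E → ℝ}
    {α R L : ℝ} (hα0 : 0 < α) (hα1 : α ≤ 1) (hb : DerivBounds φ α R L) (hμL : μ⁻¹ ≤ L)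
    {u v : E} (hu : u ∈ Metric.ball (0 : E) R)
    (hvm : v ∈ massSphere ι μ) (hv : v ∈ Metric.ball (0 : E) R) {ρ : ℝ} (hρ1 : ρ ≤ 1)
    (hρ : ‖u - v‖ ≤ ρ) :
    ‖constrainedDeriv ι φ u‖ ≤ ‖constrainedDeriv ι φ v‖ + 3 * L ^ 3 * ρ ^ α := by
  have hL := hb.one_le
  have hL0 : 0 < L := by linarith
  have hρ0 : 0 ≤ ρ := (norm_nonneg _).trans hρ
  have hω : ρ ≤ ρ ^ α := by
    simpa using Real.rpow_le_rpow_of_exponent_ge' hρ0 hρ1 hα0.le hα1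
  have hω0 : 0 ≤ ρ ^ α := by positivity
  have hvL : ‖v‖ ≤ L := (mem_ball_zero_iff.1 hv).le.trans hb.radius_le
  have hcd : ‖constrainedDeriv ι φ v‖ ≤ L := by
    refine ContinuousLinearMap.opNorm_le_bound _ hL0.le fun w => ?_
    exact ((fderiv ℝ φ v).le_opNorm w).trans
      (mul_le_mul_of_nonneg_right (hb.norm_fderiv_le v hv) (norm_nonneg _))
  refine ContinuousLinearMap.opNorm_le_bound _ (by positivity) fun w => ?_
  have hpw := norm_tangentProj_sub_le (u := v) (v := u) hι hμ w.2
  have hp := tangentProj_mem hμ hvm (w : E)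
  set p := tangentProj ι μ v (w : E)
  have hw0 := norm_nonneg (w : E)
  have hpw' : ‖p - w‖ ≤ ρ ^ α * L ^ 2 * ‖(w : E)‖ := by
    refine hpw.trans ?_
    rw [norm_sub_rev v u]
    calc ‖u - v‖ * ‖(w : E)‖ * μ⁻¹ * ‖v‖ ≤ ρ ^ α * ‖(w : E)‖ * L * L := by
          have := hρ.trans hω
          gcongr
      _ = ρ ^ α * L ^ 2 * ‖(w : E)‖ := by ring
  have h1 : ‖(fderiv ℝ φ u - fderiv ℝ φ v) w‖ ≤ L * ρ ^ α * ‖(w : E)‖ := by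
    refine (ContinuousLinearMap.le_opNorm _ _).trans ?_
    have : ‖u - v‖ ^ α ≤ ρ ^ α := Real.rpow_le_rpow (norm_nonneg _) hρ hα0.le
    gcongr
    exact (hb.holder u hu v hv).trans (by gcongr)
  have h2 : ‖fderiv ℝ φ v (w - p)‖ ≤ L * (ρ ^ α * L ^ 2 * ‖(w : E)‖) := by
    refine (ContinuousLinearMap.le_opNorm _ _).trans ?_
    rw [norm_sub_rev]
    have := hb.norm_fderiv_le v hv
    gcongr
  have h3 : ‖fderiv ℝ φ v p‖
      ≤ ‖constrainedDeriv ι φ v‖ * ‖(w : E)‖ + L * (ρ ^ α * L ^ 2 * ‖(w : E)‖) := by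
    have h4 : ‖p‖ ≤ ‖(w : E)‖ + ρ ^ α * L ^ 2 * ‖(w : E)‖ := by
      have := norm_le_norm_add_norm_sub' p (w : E)
      linarith
    calc ‖fderiv ℝ φ v p‖ ≤ ‖constrainedDeriv ι φ v‖ * ‖p‖ :=
          (constrainedDeriv ι φ v).le_opNorm ⟨p, hp⟩
      _ ≤ ‖constrainedDeriv ι φ v‖ * (‖(w : E)‖ + ρ ^ α * L ^ 2 * ‖(w : E)‖) := by gcongr
      _ ≤ _ := by rw [mul_add]; gcongr
  have h4 : fderiv ℝ φ u w
      = (fderiv ℝ φ u - fderiv ℝ φ v) w + fderiv ℝ φ v p + fderiv ℝ φ v (w - p) := by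
    rw [sub_apply, map_sub]; ring
  have h5 : ‖fderiv ℝ φ u w‖ ≤ (‖constrainedDeriv ι φ v‖ + 3 * L ^ 3 * ρ ^ α) * ‖(w : E)‖ := by
    rw [h4]
    refine (norm_add₃_le ..).trans ?_
    have h6 : L * ρ ^ α * ‖(w : E)‖ ≤ L ^ 3 * ρ ^ α * ‖(w : E)‖ := by
      gcongr; exact le_self_pow₀ hL (by norm_num)
    linarith
  exact h5

/-- Since `φ` is even only on the constraint, the identity `φ(-γ) = φ(γ)` is differentiated along a
curve `γ` in the constraint; it gives information in tangent directions only. -/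
theorem fderiv_neg_apply_of_even (hμ : 0 < μ) {φ : E → ℝ} (hφ : Differentiable ℝ φ)
    (heven : ∀ u ∈ massSphere ι μ, φ (-u) = φ u) {u w : E} (hu : u ∈ massSphere ι μ)
    (hw : w ∈ tangentSpace ι u) : fderiv ℝ φ (-u) w = -fderiv ℝ φ u w := by
  have hp : tangentProj ι μ u w = w := by
    rw [tangentProj, mem_tangentSpace.1 hw, zero_div, zero_smul, sub_zero]
  have hγ : HasDerivAt (fun s : ℝ => sphereMove ι μ u w s) w 0 := by
    have hform : (fun s : ℝ => sphereMove ι μ u w s)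
        = fun s : ℝ => (√μ / √(μ + s ^ 2 * ‖ι w‖ ^ 2)) • (u + s • w) := by
      ext s
      rw [sphereMove, hp, ← norm_sq_map_add_smul hu hw s, Real.sqrt_sq (norm_nonneg _)]
    have hsq : HasDerivAt (fun s : ℝ => μ + s ^ 2 * ‖ι w‖ ^ 2) 0 0 := by
      simpa using ((hasDerivAt_pow 2 (0 : ℝ)).mul_const (‖ι w‖ ^ 2)).const_add μ
    have hden : HasDerivAt (fun s : ℝ => √μ / √(μ + s ^ 2 * ‖ι w‖ ^ 2)) 0 0 := by
      have h1 := hsq.sqrt (by simpa using hμ.ne')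
      have h2 := (hasDerivAt_const (0 : ℝ) √μ).div h1 (by simpa using (Real.sqrt_pos.2 hμ).ne')
      refine h2.congr_deriv ?_
      simp
    have hlin : HasDerivAt (fun s : ℝ => u + s • w) w 0 := by
      simpa using ((hasDerivAt_id (0 : ℝ)).smul_const w).const_add u
    rw [hform]
    refine (hden.smul hlin).congr_deriv ?_
    simp [div_self (Real.sqrt_pos.2 hμ).ne']
  have h0 := sphereMove_zero hμ hu w
  have h1 : HasDerivAt (fun s : ℝ => φ (sphereMove ι μ u w s)) (fderiv ℝ φ u w) 0 := by
    have := (hφ (sphereMove ι μ u w 0)).hasFDerivAt.comp_hasDerivAt (0 : ℝ) hγ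
    rwa [h0] at this
  have h2 : HasDerivAt (fun s : ℝ => φ (-sphereMove ι μ u w s)) (fderiv ℝ φ (-u) (-w)) 0 := by
    have := (hφ (-sphereMove ι μ u w 0)).hasFDerivAt.comp_hasDerivAt (0 : ℝ) hγ.neg
    rwa [h0] at this
  have h3 : (fun s : ℝ => φ (-sphereMove ι μ u w s)) = fun s : ℝ => φ (sphereMove ι μ u w s) :=
    funext fun s => heven _ (sphereMove_mem hμ hu w s)
  rw [h3] at h2
  have := h1.unique h2
  rw [map_neg] at this
  linarith

theorem norm_constrainedDeriv_neg (hμ : 0 < μ) {φ : E → ℝ} (hφ : Differentiable ℝ φ)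
    (heven : ∀ u ∈ massSphere ι μ, φ (-u) = φ u) {u : E} (hu : u ∈ massSphere ι μ) :
    ‖constrainedDeriv ι φ (-u)‖ = ‖constrainedDeriv ι φ u‖ := by
  have hmem : ∀ w, w ∈ tangentSpace ι (-u) ↔ w ∈ tangentSpace ι u := fun w => by
    simp [mem_tangentSpace]
  apply le_antisymm
  · refine ContinuousLinearMap.opNorm_le_bound _ (ContinuousLinearMap.opNorm_nonneg _) fun w => ?_
    have hw := (hmem w).1 w.2
    have h := (constrainedDeriv ι φ u).le_opNorm ⟨w, hw⟩
    change ‖fderiv ℝ φ (-u) w‖ ≤ _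
    rw [fderiv_neg_apply_of_even hμ hφ heven hu hw, norm_neg]
    exact h
  · refine ContinuousLinearMap.opNorm_le_bound _ (ContinuousLinearMap.opNorm_nonneg _) fun w => ?_
    have h := (constrainedDeriv ι φ (-u)).le_opNorm ⟨w, (hmem w).2 w.2⟩
    change ‖fderiv ℝ φ (-u) w‖ ≤ _ at h
    rw [fderiv_neg_apply_of_even hμ hφ heven hu w.2, norm_neg] at h
    exact h

/-! ### One equivariant lowering step. -/

section Step

variable {d : ℕ} {σ : EuclideanSpace ℝ (Fin d) → EuclideanSpace ℝ (Fin d)}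
  {D : Set (EuclideanSpace ℝ (Fin d))}

/-- The tangential derivative of `φ` along a continuous family of points is almost nonpositive on
a continuous field of unit vectors of a subspace of dimension greater than that of the domain. -/
theorem exists_unit_field_fderiv_le {φ : E → ℝ} (hφ : ContDiff ℝ 2 φ) (hD : IsCompact D)
    {g : EuclideanSpace ℝ (Fin d) → E} (hg : ContinuousOn g D) (W : Submodule ℝ E)
    (hW : Module.finrank ℝ W = d + 1) {τ : ℝ} (hτ : 0 < τ) :
    ∃ w : EuclideanSpace ℝ (Fin d) → E, Continuous w ∧ (∀ x, w x ∈ W) ∧ (∀ x, ‖w x‖ = 1) ∧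
      ∀ x ∈ D, fderiv ℝ φ (g x) (tangentProj ι μ (g x) (w x)) ≤ τ := by
  have : FiniteDimensional ℝ W := Module.finite_of_finrank_pos (by omega)
  -- The map `w ↦ φ'(u)[tangentProj u w]` on the fixed space `W`; the Riesz isomorphism turns it
  -- into a vector of `W`, whose dimension exceeds that of the parameter space.
  let ℓ : E → (W →L[ℝ] ℝ) := fun u =>
    (fderiv ℝ φ u - (fderiv ℝ φ u u / μ) • (innerSL ℝ (ι u)).comp ι).comp W.subtypeL
  have hφ' : Continuous (fderiv ℝ φ) := hφ.continuous_fderiv (by norm_num)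
  have hℓ : Continuous ℓ := by
    have h1 : Continuous fun u => fderiv ℝ φ u u := hφ'.clm_apply continuous_id
    have h2 : Continuous fun u => (innerSL ℝ (ι u)).comp ι :=
      ((innerSL ℝ).continuous.comp ι.continuous).clm_comp continuous_const
    exact (hφ'.sub ((h1.div_const μ).smul h2)).clm_comp continuous_const
  obtain ⟨w, hw, hw1, hwτ⟩ := exists_unit_field_inner_le (F := W)
    (A := fun x => (InnerProductSpace.toDual ℝ W).symm (ℓ (g x))) (by simp [hW]) hD
    ((InnerProductSpace.toDual ℝ W).symm.continuous.comp_continuousOn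
      (hℓ.comp_continuousOn hg)) hτ
  refine ⟨fun x => w x, continuous_subtype_val.comp hw, fun x => (w x).2, hw1, fun x hx => ?_⟩
  have h := hwτ x hx
  rw [InnerProductSpace.toDual_symm_apply] at h
  have h2 : ℓ (g x) (w x) = fderiv ℝ φ (g x) (tangentProj ι μ (g x) (w x)) := by
    simp only [ℓ, tangentProj, map_sub, map_smul, smul_eq_mul]
    simp
    ring
  rwa [← h2]

/-- One deformation step: near the orbit of `z`, where the images are close to a point `u₀` at
which the constrained Hessian is negative definite on a space of dimension `d + 1`, an equivariant
map is deformed so as to decrease the functional. -/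
theorem exists_equivariant_step (hι : ‖ι‖ ≤ 1) (hμ : 0 < μ) {φ : E → ℝ} (hφ : ContDiff ℝ 2 φ)
    (heven : ∀ u ∈ massSphere ι μ, φ (-u) = φ u)
    {α R L : ℝ} (hα0 : 0 < α) (hα1 : α ≤ 1) (hb : DerivBounds φ α R L) (hμL : μ⁻¹ ≤ L)
    (hσ : Isometry σ) (hσ2 : Function.Involutive σ) (hD : IsCompact D) (hσD : σ '' D = D)
    {g : EuclideanSpace ℝ (Fin d) → E} (hg : IsEquivariant ι μ σ D g)
    {z : EuclideanSpace ℝ (Fin d)} {h : ℝ} (hh : 0 < h)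
    (hdisj : ∀ x ∈ D, dist x z < 4 * h → 4 * h ≤ dist (σ x) z)
    {u₀ : E} (hu₀m : u₀ ∈ massSphere ι μ) (hu₀ : u₀ ∈ Metric.ball (0 : E) (R - 1))
    {lam : ℝ} {W : Submodule ℝ E} (hWT : W ≤ tangentSpace ι u₀)
    (hW : Module.finrank ℝ W = d + 1)
    (hneg : ∀ w ∈ W, w ≠ 0 → constrainedHessian ι φ u₀ w w < -lam * ‖w‖ ^ 2)
    {ρ δ τ : ℝ} (hδ : 0 < δ) (hτ : 0 < τ) (hρ : ρ ≤ 1 / 2) (hδρ : 8 * L ^ 10 * δ ≤ ρ)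
    (hρlam : 1000 * L ^ 40 * ρ ^ α ≤ lam / 4)
    (hnear : ∀ x ∈ D, dist x z < 4 * h → ‖g x - u₀‖ ≤ ρ) :
    ∃ g', IsEquivariant ι μ σ D g' ∧ ∀ x ∈ D,
      ‖g' x - g x‖ ≤ 8 * L ^ 10 * δ ∧ φ (g' x) ≤ φ (g x) + δ * τ ∧
      (4 * h ≤ dist x z → 4 * h ≤ dist (σ x) z → g' x = g x) ∧
      (dist x z ≤ 3 * h ∨ dist (σ x) z ≤ 3 * h →
        φ (g' x) ≤ φ (g x) + δ * τ - δ ^ 2 * lam / 4) := by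
  have hL := hb.one_le
  have hL0 : 0 < L := by linarith
  have hσmem : ∀ x ∈ D, σ x ∈ D := fun x hx => hσD ▸ mem_image_of_mem σ hx
  have hρ0 : 0 < ρ := lt_of_lt_of_le (by positivity) hδρ
  have hlam : 0 ≤ lam := by
    have : 0 ≤ 1000 * L ^ 40 * ρ ^ α := by positivity
    linarith
  obtain ⟨w, hw, hwW, hw1, hwτ⟩ := exists_unit_field_fderiv_le (ι := ι) (μ := μ) hφ hD
    hg.continuousOn W hW hτ
  let ψ : EuclideanSpace ℝ (Fin d) → ℝ := fun x => max 0 (min 1 (4 - dist x z / h))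
  have hψ : Continuous ψ := by fun_prop
  have hψ0 : ∀ x, 0 ≤ ψ x := fun x => le_max_left _ _
  have hψ1 : ∀ x, ψ x ≤ 1 := fun x => max_le zero_le_one (min_le_left _ _)
  have hψout : ∀ x, 4 * h ≤ dist x z → ψ x = 0 := fun x hx => by
    have : 4 ≤ dist x z / h := (le_div_iff₀ hh).2 hx
    exact max_eq_left ((min_le_right _ _).trans (by linarith))
  have hψin : ∀ x, dist x z ≤ 3 * h → ψ x = 1 := fun x hx => by
    have : dist x z / h ≤ 3 := (div_le_iff₀ hh).2 hx
    have h2 : min 1 (4 - dist x z / h) = 1 := min_eq_left (by linarith)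
    simp only [ψ, h2]
    norm_num
  let m : EuclideanSpace ℝ (Fin d) → E := fun x => sphereMove ι μ (g x) (w x) (δ * ψ x)
  have hm : ContinuousOn m D := continuousOn_sphereMove hμ hg.continuousOn hg.mapsTo
    hw.continuousOn (continuousOn_const.mul hψ.continuousOn)
  have hmmem : ∀ x ∈ D, m x ∈ massSphere ι μ := fun x hx => sphereMove_mem hμ (hg.mapsTo hx) _ _
  have hmout : ∀ x ∈ D, 4 * h ≤ dist x z → m x = g x := fun x hx hxz => by
    simp only [m, hψout x hxz, mul_zero]
    exact sphereMove_zero hμ (hg.mapsTo hx) _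
  have hL10 : δ ≤ 8 * L ^ 10 * δ :=
    le_mul_of_one_le_left hδ.le (by linarith [one_le_pow₀ hL (n := 10)])
  have hmin : ∀ x ∈ D, dist x z < 4 * h → ‖m x - g x‖ ≤ 8 * L ^ 10 * δ ∧
      φ (m x) ≤ φ (g x) + δ * τ - (δ * ψ x) ^ 2 * lam / 4 := by
    intro x hx hxz
    have hgx := hnear x hx hxz
    have hu₀n := mem_ball_zero_iff.1 hu₀
    have hgn : ‖g x‖ < R - 1 / 2 := by linarith [norm_le_norm_add_norm_sub' (g x) u₀]
    have hs0 : 0 ≤ δ * ψ x := mul_nonneg hδ.le (hψ0 x)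
    have hsδ : δ * ψ x ≤ δ := mul_le_of_le_one_right hδ.le (hψ1 x)
    have hgL : ‖g x‖ ≤ L := by linarith [hb.radius_le]
    have hmove := (norm_sphereMove_sub_le hι hμ hL hμL (hg.mapsTo hx) hgL (hw1 x) hs0
      (by linarith)).2
    have hmove' : ‖m x - g x‖ ≤ 8 * L ^ 10 * δ := hmove.trans (by gcongr)
    refine ⟨hmove', ?_⟩
    have hmain := le_add_constrainedHessian hι hμ hφ hα0 hα1 hb hμL hu₀m
      (mem_ball_zero_iff.2 (by linarith)) (hg.mapsTo hx) (mem_ball_zero_iff.2 (by linarith))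
      (hWT (hwW x)) (hw1 x) (by linarith) hgx hs0 (by linarith)
      (mem_ball_zero_iff.2 (by linarith [norm_le_norm_add_norm_sub' (m x) (g x)])) hτ.le
      (hwτ x hx)
    have hH := hneg (w x) (hwW x) (fun h0 => by simpa [h0] using hw1 x)
    rw [hw1 x, one_pow, mul_one] at hH
    -- The Hessian gains `lam / 2` times the squared step and the Taylor error takes back at most
    -- `lam / 4`.
    have e1 := mul_le_mul_of_nonneg_left hH.le (by positivity : 0 ≤ (δ * ψ x) ^ 2 / 2)
    have e2 := mul_le_mul_of_nonneg_left hρlam (sq_nonneg (δ * ψ x))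
    have e3 : δ * ψ x * τ ≤ δ * τ := by gcongr
    change φ (sphereMove ι μ (g x) (w x) (δ * ψ x)) ≤ _
    linarith
  have hcase1 : ∀ x ∈ D, 4 * h ≤ dist (σ x) z → m x - m (σ x) - g x = m x := fun x hx hxz => by
    rw [hmout _ (hσmem x hx) hxz, hg.equivariant x hx]; abel
  have hcase2 : ∀ x ∈ D, 4 * h ≤ dist x z → m x - m (σ x) - g x = -m (σ x) := fun x hx hxz => by
    rw [hmout x hx hxz]; abel
  have hφσ : ∀ x ∈ D, φ (g (σ x)) = φ (g x) := fun x hx => by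
    rw [hg.equivariant x hx, heven _ (hg.mapsTo hx)]
  have hδτ : 0 < δ * τ := mul_pos hδ hτ
  -- This formula is odd under `σ` and continuous without gluing. At most one of `x`, `σ x` lies in
  -- the ball of radius `4 * h`, so its value is always `m x` or `-m (σ x)` and stays on the
  -- constraint.
  refine ⟨fun x => m x - m (σ x) - g x, ⟨?_, ?_, ?_⟩, fun x hx => ?_⟩
  · exact (hm.sub (hm.comp hσ.continuous.continuousOn hσmem)).sub hg.continuousOn
  · intro x hx
    rcases le_or_gt (4 * h) (dist x z) with hxz | hxz
    · simp only [hcase2 x hx hxz]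
      exact neg_mem_massSphere.2 (hmmem _ (hσmem x hx))
    · simp only [hcase1 x hx (hdisj x hx hxz)]
      exact hmmem x hx
  · intro x hx
    simp only [hσ2 x, hg.equivariant x hx]
    abel
  · have key : ∀ y ∈ D, ‖m y - g y‖ ≤ 8 * L ^ 10 * δ ∧ φ (m y) ≤ φ (g y) + δ * τ ∧
        (dist y z ≤ 3 * h → φ (m y) ≤ φ (g y) + δ * τ - δ ^ 2 * lam / 4) := by
      intro y hy
      rcases le_or_gt (4 * h) (dist y z) with hyz | hyz
      · rw [hmout y hy hyz, sub_self, norm_zero]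
        exact ⟨by positivity, by linarith, fun h3 => by linarith⟩
      · obtain ⟨h1, h2⟩ := hmin y hy hyz
        have h3 : 0 ≤ (δ * ψ y) ^ 2 * lam / 4 := by positivity
        refine ⟨h1, by linarith, fun h4 => ?_⟩
        rwa [hψin y h4, mul_one] at h2
    rcases le_or_gt (4 * h) (dist x z) with hxz | hxz
    · obtain ⟨h1, h2, h3⟩ := key _ (hσmem x hx)
      rw [hφσ x hx] at h2 h3
      rw [← heven _ (hmmem _ (hσmem x hx))] at h2 h3
      simp only [hcase2 x hx hxz]
      refine ⟨?_, h2, fun _ h4 => ?_, fun h4 => h3 (h4.resolve_left (by linarith))⟩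
      · rw [hg.equivariant x hx] at h1
        rwa [← norm_neg, neg_sub, sub_neg_eq_add, add_comm, ← sub_neg_eq_add]
      · rw [hmout _ (hσmem x hx) h4, hg.equivariant x hx, neg_neg]
    · have hσx := hdisj x hx hxz
      obtain ⟨h1, h2, h3⟩ := key x hx
      simp only [hcase1 x hx hσx]
      exact ⟨h1, h2, fun h4 => absurd hxz h4.not_gt,
        fun h4 => h3 (h4.resolve_right (by linarith))⟩

end Step

/-! ### Composition of finitely many steps. -/

variable {d : ℕ} {σ : EuclideanSpace ℝ (Fin d) → EuclideanSpace ℝ (Fin d)}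
  {D : Set (EuclideanSpace ℝ (Fin d))}

/-- Finitely many deformation steps, around centres `z i` whose balls of radius `4h` overlap at
most `n` times. -/
theorem exists_equivariant_deformation (hι : ‖ι‖ ≤ 1) (hμ : 0 < μ) {φ : E → ℝ}
    (hφ : ContDiff ℝ 2 φ) (heven : ∀ u ∈ massSphere ι μ, φ (-u) = φ u)
    {α R L : ℝ} (hα0 : 0 < α) (hα1 : α ≤ 1) (hb : DerivBounds φ α R L) (hμL : μ⁻¹ ≤ L)
    (hσ : Isometry σ) (hσ2 : Function.Involutive σ) (hD : IsCompact D) (hσD : σ '' D = D)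
    {f : EuclideanSpace ℝ (Fin d) → E} (hf : IsEquivariant ι μ σ D f) {J : Type*} (I : Finset J)
    {z : J → EuclideanSpace ℝ (Fin d)} {u₀ : J → E} {W : J → Submodule ℝ E} {h : ℝ} (hh : 0 < h)
    (hdisj : ∀ i ∈ I, ∀ x ∈ D, dist x (z i) < 4 * h → 4 * h ≤ dist (σ x) (z i))
    (hu₀m : ∀ i ∈ I, u₀ i ∈ massSphere ι μ)
    (hu₀ : ∀ i ∈ I, u₀ i ∈ Metric.ball (0 : E) (R - 1)) {lam : ℝ}
    (hWT : ∀ i ∈ I, W i ≤ tangentSpace ι (u₀ i))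
    (hW : ∀ i ∈ I, Module.finrank ℝ (W i) = d + 1)
    (hneg : ∀ i ∈ I, ∀ w ∈ W i, w ≠ 0 → constrainedHessian ι φ (u₀ i) w w < -lam * ‖w‖ ^ 2)
    {ρ δ : ℝ} {n : ℕ} (hδ : 0 < δ) (hρ : ρ ≤ 1 / 2)
    (hδρ : 8 * L ^ 10 * δ * (n + 1) ≤ ρ / 2) (hρlam : 1000 * L ^ 40 * ρ ^ α ≤ lam / 4)
    (hnear : ∀ i ∈ I, ∀ x ∈ D, dist x (z i) < 4 * h → ‖f x - u₀ i‖ ≤ ρ / 2)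
    (hn : ∀ x ∈ D, ∀ Y ⊆ I, (∀ i ∈ Y, dist x (z i) < 4 * h ∨ dist (σ x) (z i) < 4 * h) →
      Y.card ≤ n)
    {e : ℝ} (he : 0 < e) :
    ∃ g, IsEquivariant ι μ σ D g ∧ ∀ x ∈ D,
      ‖g x - f x‖ ≤ ρ / 2 ∧ φ (g x) ≤ φ (f x) + e ∧
      ((∀ i ∈ I, 4 * h ≤ dist x (z i) ∧ 4 * h ≤ dist (σ x) (z i)) → g x = f x) ∧
      (∀ i ∈ I, dist x (z i) ≤ 3 * h ∨ dist (σ x) (z i) ≤ 3 * h →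
        φ (g x) ≤ φ (f x) + e - δ ^ 2 * lam / 4) := by
  classical
  have hL0 : 0 < L := by linarith [hb.one_le]
  have hK : 0 ≤ 8 * L ^ 10 * δ := by positivity
  have hδρ' : 8 * L ^ 10 * δ ≤ ρ / 2 :=
    (le_mul_of_one_le_right hK (by linarith [n.cast_nonneg (α := ℝ)])).trans hδρ
  have hbound : ∀ k : ℕ, k ≤ n → 8 * L ^ 10 * δ * k ≤ ρ / 2 := fun k hk => by
    refine le_trans ?_ hδρ
    have : (k : ℝ) ≤ n := by exact_mod_cast hk
    gcongr
    linarith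
  have hρ0 : 0 ≤ ρ := by linarith
  have hlam : 0 ≤ lam := by
    have : 0 ≤ 1000 * L ^ 40 * ρ ^ α := by positivity
    linarith
  -- Chosen so that the first-order errors of all steps together stay below `e`.
  set τ : ℝ := e / (δ * (I.card + 1)) with hτdef
  have hc1 : (0 : ℝ) < I.card + 1 := by positivity
  have hτ : 0 < τ := by positivity
  -- The displacement of `x` is charged only to the balls containing `x` or `σ x`, at most `n` of
  -- them, whereas the error in `φ` is charged to every step. The displacement bound `ρ / 2` keeps
  -- each intermediate map within `ρ` of the next `u₀ j`.
  suffices key : ∀ Y ⊆ I, ∃ g, IsEquivariant ι μ σ D g ∧ ∀ x ∈ D,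
      (∃ Y₀ ⊆ Y, (∀ i ∈ Y₀, dist x (z i) < 4 * h ∨ dist (σ x) (z i) < 4 * h) ∧
        ‖g x - f x‖ ≤ 8 * L ^ 10 * δ * Y₀.card) ∧
      φ (g x) ≤ φ (f x) + Y.card * (δ * τ) ∧
      ((∀ i ∈ Y, 4 * h ≤ dist x (z i) ∧ 4 * h ≤ dist (σ x) (z i)) → g x = f x) ∧
      (∀ i ∈ Y, dist x (z i) ≤ 3 * h ∨ dist (σ x) (z i) ≤ 3 * h →
        φ (g x) ≤ φ (f x) + Y.card * (δ * τ) - δ ^ 2 * lam / 4) by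
    obtain ⟨g, hg, hgx⟩ := key I subset_rfl
    have hcard : I.card * (δ * τ) ≤ e := by
      rw [hτdef]
      field_simp
      linarith
    refine ⟨g, hg, fun x hx => ?_⟩
    obtain ⟨⟨Y₀, hY₀, hY₀x, hd⟩, h2, h3, h4⟩ := hgx x hx
    exact ⟨hd.trans (hbound _ (hn x hx Y₀ hY₀ hY₀x)), by linarith, h3,
      fun i hi hxi => by linarith [h4 i hi hxi]⟩
  intro Y
  induction Y using Finset.induction_on with
  | empty =>
    refine fun _ => ⟨f, hf, fun x hx => ⟨⟨∅, subset_rfl, by simp, by simp⟩, by simp,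
      fun _ => rfl, by simp⟩⟩
  | insert j Y hj ih =>
    intro hjY
    obtain ⟨hjI, hYI⟩ := Finset.insert_subset_iff.1 hjY
    obtain ⟨g, hg, hgx⟩ := ih hYI
    obtain ⟨g', hg', hgx'⟩ := exists_equivariant_step hι hμ hφ heven hα0 hα1 hb hμL hσ hσ2 hD hσD
      hg hh (hdisj j hjI) (hu₀m j hjI) (hu₀ j hjI) (hWT j hjI) (hW j hjI) (hneg j hjI) hδ hτ hρ
      (by linarith) hρlam (fun x hx hxz => by
        obtain ⟨⟨Y₀, hY₀, hY₀x, hd⟩, -⟩ := hgx x hx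
        have h1 := hd.trans (hbound _ (hn x hx Y₀ (hY₀.trans hYI) hY₀x))
        have h2 := hnear j hjI x hx hxz
        have h3 := norm_add_le (g x - f x) (f x - u₀ j)
        rw [sub_add_sub_cancel] at h3
        linarith)
    refine ⟨g', hg', fun x hx => ?_⟩
    obtain ⟨⟨Y₀, hY₀, hY₀x, hd⟩, h2, h3, h4⟩ := hgx x hx
    obtain ⟨s1, s2, s3, s4⟩ := hgx' x hx
    have hcard : ((insert j Y).card : ℝ) = Y.card + 1 := by
      rw [Finset.card_insert_of_notMem hj]; push_cast; ring
    rw [hcard]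
    refine ⟨?_, by linarith, fun hfar => ?_, fun i hi hxi => ?_⟩
    · by_cases hxj : dist x (z j) < 4 * h ∨ dist (σ x) (z j) < 4 * h
      · refine ⟨insert j Y₀, Finset.insert_subset_insert _ hY₀, fun i hi => ?_, ?_⟩
        · rcases Finset.mem_insert.1 hi with rfl | hi'
          · exact hxj
          · exact hY₀x i hi'
        · rw [Finset.card_insert_of_notMem fun h => hj (hY₀ h)]
          have h5 := norm_add_le (g' x - g x) (g x - f x)
          rw [sub_add_sub_cancel] at h5
          push_cast
          linarith
      · push Not at hxj
        refine ⟨Y₀, hY₀.trans (Finset.subset_insert _ _), hY₀x, ?_⟩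
        rw [s3 hxj.1 hxj.2]
        exact hd
    · have hj' := hfar j (Finset.mem_insert_self _ _)
      rw [s3 hj'.1 hj'.2]
      exact h3 fun i hi => hfar i (Finset.mem_insert_of_mem hi)
    · rcases Finset.mem_insert.1 hi with rfl | hi'
      · linarith [s4 hxi]
      · linarith [h4 i hi' hxi]

end Sphere

/-! ### Deforming a map below the critical level. -/

/-- A negative space may be infinite-dimensional; the unit field needs only a finite-dimensional
piece, one dimension above the parameter space. -/
theorem exists_submodule_finrank_eq_succ {E : Type*} [AddCommGroup E] [Module ℝ E]
    {W : Submodule ℝ E} {d : ℕ} (h : ¬ Module.rank ℝ W ≤ d) :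
    ∃ W' ≤ W, Module.finrank ℝ W' = d + 1 := by
  have h1 : ((d + 1 : ℕ) : Cardinal) ≤ Module.rank ℝ W := by
    rw [Nat.cast_succ, ← Cardinal.succ_natCast]
    exact Order.succ_le_of_lt (not_le.1 h)
  obtain ⟨l, hl⟩ := Module.le_rank_iff_exists_linearMap.1 h1
  refine ⟨(W.subtype ∘ₗ l).range, ?_, ?_⟩
  · rintro _ ⟨x, rfl⟩
    exact (l x).2
  · have hinj : Function.Injective (W.subtype ∘ₗ l) := W.subtype_injective.comp hl
    rw [LinearMap.finrank_range_of_inj hinj]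
    simp

section Sphere

variable {E H : Type*} [NormedAddCommGroup E] [InnerProductSpace ℝ E]
  [NormedAddCommGroup H] [InnerProductSpace ℝ H] {ι : E →L[ℝ] H} {μ : ℝ}

variable {d : ℕ} {σ : EuclideanSpace ℝ (Fin d) → EuclideanSpace ℝ (Fin d)}
  {D : Set (EuclideanSpace ℝ (Fin d))}

/-- An equivariant map into the constraint moves every point together with its mirror image by a
definite amount, so there is a scale on which it is nearly constant and mirror images are apart. -/
theorem IsEquivariant.exists_scale (hι : ‖ι‖ ≤ 1) (hμ : 0 < μ) (hD : IsCompact D)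
    (hσD : σ '' D = D) {f : EuclideanSpace ℝ (Fin d) → E} (hf : IsEquivariant ι μ σ D f) {ρ : ℝ}
    (hρ : 0 < ρ) :
    ∃ h : ℝ, 0 < h ∧ (∀ x ∈ D, ∀ y ∈ D, dist x y < 8 * h → ‖f x - f y‖ ≤ ρ) ∧
      ∀ x ∈ D, 8 * h ≤ dist x (σ x) := by
  have hsq : 0 < √μ := Real.sqrt_pos.2 hμ
  -- The bound `√μ` separates mirror images: `f (σ x) = -f x` lies at distance `2 * ‖f x‖ ≥ 2 * √μ`
  -- from `f x`.
  obtain ⟨r, hr, hrf⟩ := Metric.uniformContinuousOn_iff.1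
    (hD.uniformContinuousOn_of_continuous hf.continuousOn) (min ρ √μ) (lt_min hρ hsq)
  refine ⟨r / 8, by positivity, fun x hx y hy hxy => ?_, fun x hx => ?_⟩
  · rw [← dist_eq_norm]
    exact ((hrf x hx y hy (by linarith)).trans_le (min_le_left _ _)).le
  · by_contra! hlt
    have hσx : σ x ∈ D := hσD ▸ mem_image_of_mem σ hx
    have h1 := (hrf x hx _ hσx (by linarith)).trans_le (min_le_right _ _)
    rw [hf.equivariant x hx, dist_eq_norm, sub_neg_eq_add, ← two_smul ℝ, norm_smul] at h1
    have h2 := sqrt_le_norm_of_mem_massSphere hι (hf.mapsTo hx)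
    norm_num at h1
    linarith

/-- If all almost critical points of `f(D)` at levels near `c` have, up to a sign, a constrained
Hessian which is negative definite on a space of dimension `d + 1`, then `f` deforms to a map whose
image meets high levels outside `closure Q` only near noncritical points of `f(D)`. -/
theorem exists_deformation_below (hι : ‖ι‖ ≤ 1) (hμ : 0 < μ) {φ : E → ℝ}
    (hφ : ContDiff ℝ 2 φ) (heven : ∀ u ∈ massSphere ι μ, φ (-u) = φ u)
    {α R L : ℝ} (hα0 : 0 < α) (hα1 : α ≤ 1) (hb : DerivBounds φ α R L) (hμL : μ⁻¹ ≤ L)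
    (hσ : Isometry σ) (hσ2 : Function.Involutive σ) (hD : IsCompact D) (hσD : σ '' D = D)
    {f : EuclideanSpace ℝ (Fin d) → E} (hf : IsEquivariant ι μ σ D f)
    {Q : Set E} (hQ : ∀ u, -u ∈ Q ↔ u ∈ Q) {c ε lam ρ δ : ℝ} (hε : 0 < ε)
    (hfc : ∀ u ∈ (f '' D) \ closure Q, φ u ≤ c + ε)
    (hfR : {u | u ∈ (f '' D) \ Q ∧ c - ε ≤ φ u} ⊆ Metric.ball 0 (R - 1))
    (hδ : 0 < δ) (hρ : ρ ≤ 1 / 2)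
    (hδρ : 8 * L ^ 10 * δ * (2 * Besicovitch.multiplicity (EuclideanSpace ℝ (Fin d)) + 1) ≤ ρ / 2)
    (hρlam : 1000 * L ^ 40 * ρ ^ α ≤ lam / 4) (hδlam : 4 * ε ≤ δ ^ 2 * lam / 4)
    (hQfar : ∀ u ∈ massSphere ι μ, u ∈ Metric.ball 0 (R - 1) → u ∉ closure Q →
      ‖constrainedDeriv ι φ u‖ ≤ 3 * lam → ∀ v ∈ massSphere ι μ, ‖v - u‖ ≤ ρ → v ∉ closure Q)
    (hbad : ∀ x ∈ D, f x ∉ closure Q → c - ε ≤ φ (f x) → ‖constrainedDeriv ι φ (f x)‖ ≤ 3 * lam →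
      ∃ y, (y = x ∨ y = σ x) ∧ ∃ W ≤ tangentSpace ι (f y), Module.finrank ℝ W = d + 1 ∧
        ∀ w ∈ W, w ≠ 0 → constrainedHessian ι φ (f y) w w < -lam * ‖w‖ ^ 2) :
    ∃ g, IsEquivariant ι μ σ D g ∧ ∀ x ∈ D, ‖g x - f x‖ ≤ ρ / 2 ∧
      (g x ∉ closure Q → f x ∉ closure Q ∧ φ (g x) ≤ c + 2 * ε ∧
        (c - ε / 2 ≤ φ (g x) → f x ∈ Metric.ball 0 (R - 1) ∧
          3 * lam < ‖constrainedDeriv ι φ (f x)‖)) := by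
  classical
  have hL := hb.one_le
  have hρ0 : 0 < ρ := by
    have : 0 < 8 * L ^ 10 * δ *
        (2 * Besicovitch.multiplicity (EuclideanSpace ℝ (Fin d)) + 1) := by positivity
    linarith
  have hσmem : ∀ x ∈ D, σ x ∈ D := fun x hx => hσD ▸ mem_image_of_mem σ hx
  have hfσ : ∀ x ∈ D, ∀ y, (y = x ∨ y = σ x) → y ∈ D ∧ φ (f y) = φ (f x) ∧
      ‖constrainedDeriv ι φ (f y)‖ = ‖constrainedDeriv ι φ (f x)‖ ∧
      (f y ∈ closure Q ↔ f x ∈ closure Q) := by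
    rintro x hx y (rfl | rfl)
    · exact ⟨hx, rfl, rfl, Iff.rfl⟩
    · rw [hf.equivariant x hx]
      exact ⟨hσmem x hx, heven _ (hf.mapsTo hx), norm_constrainedDeriv_neg hμ
        (hφ.differentiable (by norm_num)) heven (hf.mapsTo hx), neg_mem_closure_iff hQ _⟩
  have hballR : ∀ x ∈ D, f x ∉ closure Q → c - ε ≤ φ (f x) → f x ∈ Metric.ball 0 (R - 1) :=
    fun x hx h1 h2 => hfR ⟨⟨mem_image_of_mem f hx, fun h3 => h1 (subset_closure h3)⟩, h2⟩
  obtain ⟨h, hh, hhf, hhσ⟩ := hf.exists_scale hι hμ hD hσD (half_pos hρ0)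
  obtain ⟨Z, hZD, hZn⟩ := exists_finset_cover_bounded_overlap hD hh
  let bad : EuclideanSpace ℝ (Fin d) → Prop := fun x => x ∈ D ∧ f x ∉ closure Q ∧
    c - ε ≤ φ (f x) ∧ ‖constrainedDeriv ι φ (f x)‖ ≤ 3 * lam
  let I := Z.filter fun z => ∃ x, bad x ∧ dist x z ≤ 3 * h
  -- Evenness on the constraint was transferred to first derivatives only, so the negative space may
  -- sit at `σ x` instead of `x`. The centre is then replaced by its mirror image, which leaves the
  -- pair of balls unchanged. The values for `i ∉ I` are dummies.
  have hdata : ∀ i, ∃ z y, ∃ W : Submodule ℝ E, i ∈ I → (z = i ∨ z = σ i) ∧ bad y ∧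
      dist y z ≤ 3 * h ∧ W ≤ tangentSpace ι (f y) ∧ Module.finrank ℝ W = d + 1 ∧
      ∀ w ∈ W, w ≠ 0 → constrainedHessian ι φ (f y) w w < -lam * ‖w‖ ^ 2 := by
    intro i
    by_cases hi : i ∈ I
    · obtain ⟨-, x, hx, hxi⟩ := Finset.mem_filter.1 hi
      obtain ⟨y, hy, W, hWT, hW, hWn⟩ := hbad x hx.1 hx.2.1 hx.2.2.1 hx.2.2.2
      obtain ⟨k1, k2, k3, k4⟩ := hfσ x hx.1 y hy
      have hy' : bad y := ⟨k1, k4.not.2 hx.2.1, k2 ▸ hx.2.2.1, k3 ▸ hx.2.2.2⟩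
      rcases hy with rfl | rfl
      · exact ⟨i, y, W, fun _ => ⟨Or.inl rfl, hy', hxi, hWT, hW, hWn⟩⟩
      · exact ⟨σ i, σ x, W, fun _ => ⟨Or.inr rfl, hy', by rwa [hσ.dist_eq], hWT, hW, hWn⟩⟩
    · exact ⟨0, 0, ⊥, fun h => absurd h hi⟩
  choose z y W hzyW using hdata
  have hdistσ : ∀ x i, dist (σ x) i = dist x (σ i) := fun x i => by
    rw [← hσ.dist_eq x, hσ2 i]
  have hswap : ∀ i ∈ I, ∀ x b, (dist x (z i) < b ∨ dist (σ x) (z i) < b) ↔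
      (dist x i < b ∨ dist (σ x) i < b) := by
    intro i hi x b
    rcases (hzyW i hi).1 with h1 | h1
    · rw [h1]
    · rw [h1, hσ.dist_eq, ← hdistσ, or_comm]
  have hswap' : ∀ i ∈ I, ∀ x b, dist x i ≤ b → (dist x (z i) ≤ b ∨ dist (σ x) (z i) ≤ b) := by
    intro i hi x b hx
    rcases (hzyW i hi).1 with h1 | h1
    · rw [h1]; exact Or.inl hx
    · rw [h1, hσ.dist_eq]; exact Or.inr hx
  have hnear : ∀ i ∈ I, ∀ x ∈ D, dist x (z i) < 4 * h → ‖f x - f (y i)‖ ≤ ρ / 2 := by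
    intro i hi x hx hxz
    obtain ⟨-, hy, hyz, -⟩ := hzyW i hi
    refine hhf x hx _ hy.1 ?_
    linarith [dist_triangle_right x (y i) (z i)]
  -- The overlap bound is twice the multiplicity because both `x` and `σ x` count. With error `ε /
  -- 2` and gain at least `4 * ε`, almost critical points fall from level `c + ε` to below `c - ε /
  -- 2`.
  obtain ⟨g, hg, hgx⟩ := exists_equivariant_deformation hι hμ hφ heven hα0 hα1 hb hμL hσ hσ2 hD hσD
    hf I (z := z) (u₀ := fun i => f (y i)) (W := W) hh
    (fun i hi x hx hxz => by
      by_contra! hlt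
      linarith [hhσ x hx, dist_triangle_right x (σ x) (z i)])
    (fun i hi => hf.mapsTo (hzyW i hi).2.1.1)
    (fun i hi => hballR _ (hzyW i hi).2.1.1 (hzyW i hi).2.1.2.1 (hzyW i hi).2.1.2.2.1)
    (fun i hi => (hzyW i hi).2.2.2.1) (fun i hi => (hzyW i hi).2.2.2.2.1)
    (fun i hi => (hzyW i hi).2.2.2.2.2) (ρ := ρ)
    (n := 2 * Besicovitch.multiplicity (EuclideanSpace ℝ (Fin d))) hδ hρ
    (by push_cast; exact hδρ) hρlam hnear
    (fun x hx Y hY hYx => by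
      have hsub : Y ⊆ (Y.filter fun i => dist x i ≤ 4 * h) ∪
          Y.filter fun i => dist (σ x) i ≤ 4 * h := fun i hi => by
        rw [Finset.mem_union, Finset.mem_filter, Finset.mem_filter]
        exact ((hswap i (hY hi) x _).1 (hYx i hi)).imp (fun h => ⟨hi, h.le⟩) fun h => ⟨hi, h.le⟩
      have hYZ : Y ⊆ Z := hY.trans (Finset.filter_subset _ _)
      have h1 := hZn x (Y.filter fun i => dist x i ≤ 4 * h)
        ((Finset.filter_subset _ _).trans hYZ) fun i hi => (Finset.mem_filter.1 hi).2
      have h2 := hZn (σ x) (Y.filter fun i => dist (σ x) i ≤ 4 * h)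
        ((Finset.filter_subset _ _).trans hYZ) fun i hi => (Finset.mem_filter.1 hi).2
      have h3 := (Finset.card_le_card hsub).trans (Finset.card_union_le _ _)
      omega) (half_pos hε)
  refine ⟨g, hg, fun x hx => ?_⟩
  obtain ⟨hd, hle, hfix, hdec⟩ := hgx x hx
  refine ⟨hd, fun hgQ => ?_⟩
  -- Either `x` was not moved, or `f x` or its antipode is close to an almost critical point outside
  -- `closure Q`, so `hQfar` applies.
  have hfQ : f x ∉ closure Q := by
    by_cases hfar : ∀ i ∈ I, 4 * h ≤ dist x (z i) ∧ 4 * h ≤ dist (σ x) (z i)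
    · rwa [← hfix hfar]
    · push Not at hfar
      obtain ⟨i, hi, hxi⟩ := hfar
      obtain ⟨-, hy, -⟩ := hzyW i hi
      have hout : ∀ x' ∈ D, dist x' (z i) < 4 * h → f x' ∉ closure Q := fun x' hx' hlt =>
        hQfar _ (hf.mapsTo hy.1) (hballR _ hy.1 hy.2.1 hy.2.2.1) hy.2.1 hy.2.2.2 _
          (hf.mapsTo hx') ((hnear i hi x' hx' hlt).trans (by linarith))
      rcases lt_or_ge (dist x (z i)) (4 * h) with hlt | hge
      · exact hout x hx hlt
      · exact (hfσ x hx _ (Or.inr rfl)).2.2.2.not.1 (hout _ (hσmem x hx) (hxi hge))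
  have hfcx := hfc (f x) ⟨mem_image_of_mem f hx, hfQ⟩
  refine ⟨hfQ, by linarith, fun hlev => ?_⟩
  have hlev' : c - ε ≤ φ (f x) := by linarith
  refine ⟨hballR x hx hfQ hlev', ?_⟩
  by_contra! hcrit
  obtain ⟨i, hi, hxi⟩ := hZD x hx
  have hiI : i ∈ I := Finset.mem_filter.2 ⟨hi, x, ⟨hx, hfQ, hlev', hcrit⟩, hxi⟩
  linarith [hdec i hiI (hswap' i hiI x _ hxi)]

end Sphere

/-! ### Choice of scales and separation from `closure Q`. -/

/-- For all small `ε` there are scales `ρ`, `δ`, `ξ` compatible with the Hölder estimates. -/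
theorem exists_scales {α α₁ A B C₀ r m : ℝ} (hα : 0 < α) (hα₁0 : 0 < α₁)
    (hα₁ : α₁ ≤ α / (2 * (α + 2))) (hA : 0 < A) (hB : 0 < B) (hC₀ : 0 < C₀) (hr : 0 < r)
    (hm : 0 < m) :
    ∃ ε₀ : ℝ, 0 < ε₀ ∧ ∀ ε : ℝ, 0 < ε → ε < ε₀ → ∃ ρ δ ξ : ℝ, 0 < δ ∧ 0 < ξ ∧ ρ ≤ 1 / 2 ∧ ρ < r ∧
      4 * ε ^ α₁ < m ∧ A * ρ ^ α ≤ ε ^ α₁ / 4 ∧ B * δ ≤ ρ / 2 ∧ 4 * ε ≤ δ ^ 2 * ε ^ α₁ / 4 ∧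
      6 * ξ ≤ ρ ∧ 4 * ε / ξ ≤ 2 * C₀ * ε ^ α₁ := by
  -- With `ρ = κ * ε ^ (α₁ / α)` this gives `A * ρ ^ α = ε ^ α₁ / 4`.
  set κ : ℝ := (1 / (4 * A)) ^ (1 / α) with hκdef
  have hκ : 0 < κ := by positivity
  have hκα : κ ^ α = 1 / (4 * A) := by
    rw [hκdef, ← Real.rpow_mul (by positivity), one_div_mul_cancel hα.ne', Real.rpow_one]
  have hsmall : ∀ p : ℝ, 0 < p → ∀ b : ℝ, 0 < b → ∀ᶠ ε : ℝ in 𝓝[>] 0, ε ^ p < b := by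
    intro p hp b hb
    have h : Filter.Tendsto (fun ε : ℝ => ε ^ p) (𝓝[>] 0) (𝓝 0) := by
      have := (Real.continuousAt_rpow_const 0 p (Or.inr hp.le)).tendsto
      rw [Real.zero_rpow hp.ne'] at this
      exact this.mono_left nhdsWithin_le_nhds
    exact h.eventually_lt_const hb
  have hα₁α : 0 < α₁ / α := by positivity
  have hexp : α₁ * (2 * (α + 2)) ≤ α := (le_div_iff₀ (by positivity)).1 hα₁
  -- This restates the bound on `α₁`. Since `δ ^ 2 * ε ^ α₁` has order `ε ^ (2 * (α₁ / α) + α₁)`, a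
  -- factor `ε ^ (1 / 2)` remains to absorb the constants in `4 * ε ≤ δ ^ 2 * ε ^ α₁ / 4`.
  have hexp1 : 2 * (α₁ / α) + α₁ ≤ 1 / 2 := by
    have h1 : 2 * (α₁ / α) + α₁ = α₁ * (2 * (α + 2)) / (2 * α) := by field_simp; ring
    rw [h1, div_le_iff₀ (by positivity)]
    linarith
  have hexp2 : 1 / 2 ≤ 1 - α₁ - α₁ / α := by linarith
  have hev := (((((hsmall 1 one_pos 1 one_pos).and
    (hsmall (1 / 2) (by norm_num) (κ ^ 2 / (64 * B ^ 2)) (by positivity))).and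
    (hsmall (1 / 2) (by norm_num) (κ * C₀ / 12) (by positivity))).and
    (hsmall (α₁ / α) hα₁α (min (1 / 2) r / κ) (by positivity))).and
    (hsmall α₁ hα₁0 (m / 4) (by positivity)))
  obtain ⟨ε₀, hε₀, hall⟩ := mem_nhdsGT_iff_exists_Ioo_subset.1 hev
  refine ⟨ε₀, hε₀, fun ε hε hεlt => ?_⟩
  obtain ⟨⟨⟨⟨h1, h2⟩, h3⟩, h4⟩, h5⟩ := hall ⟨hε, hεlt⟩
  rw [Real.rpow_one] at h1
  set ρ : ℝ := κ * ε ^ (α₁ / α) with hρdef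
  have hρ : 0 < ρ := by positivity
  rw [lt_div_iff₀ hκ, mul_comm] at h4
  have hρα : ρ ^ α = 1 / (4 * A) * ε ^ α₁ := by
    rw [hρdef, Real.mul_rpow hκ.le (by positivity), hκα, ← Real.rpow_mul hε.le,
      div_mul_cancel₀ _ hα.ne']
  have hlam : 0 < ε ^ α₁ := by positivity
  have hhalf : ε ^ (1 / 2 : ℝ) * ε ^ (1 / 2 : ℝ) = ε := by
    rw [← Real.rpow_add hε]; norm_num
  -- The value of `ξ` makes the last inequality an equality; `6 * ξ ≤ ρ` then follows from `hexp2`.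
  refine ⟨ρ, ρ / (2 * B), 2 * ε ^ (1 - α₁) / C₀, by positivity, by positivity,
    (h4.trans_le (min_le_left _ _)).le, h4.trans_le (min_le_right _ _), by linarith, ?_, ?_, ?_,
    ?_, ?_⟩
  · rw [hρα]
    field_simp
    rfl
  · field_simp
    rfl
  · have e2 : ε ^ (1 / 2 : ℝ) ≤ (ε ^ (α₁ / α)) ^ 2 * ε ^ α₁ := by
      rw [← Real.rpow_natCast, ← Real.rpow_mul hε.le, ← Real.rpow_add hε]
      refine Real.rpow_le_rpow_of_exponent_ge hε h1.le ?_
      push_cast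
      linarith
    have e3 : (ρ / (2 * B)) ^ 2 * ε ^ α₁ / 4
        = κ ^ 2 / (16 * B ^ 2) * ((ε ^ (α₁ / α)) ^ 2 * ε ^ α₁) := by
      rw [hρdef]; field_simp; ring
    rw [e3]
    calc 4 * ε = 4 * (ε ^ (1 / 2 : ℝ) * ε ^ (1 / 2 : ℝ)) := by rw [hhalf]
      _ ≤ 4 * (κ ^ 2 / (64 * B ^ 2) * ε ^ (1 / 2 : ℝ)) := by gcongr
      _ = κ ^ 2 / (16 * B ^ 2) * ε ^ (1 / 2 : ℝ) := by field_simp; ring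
      _ ≤ _ := by gcongr
  · have e1 : ε ^ (1 - α₁) ≤ ε ^ (1 / 2 : ℝ) * ε ^ (α₁ / α) := by
      rw [← Real.rpow_add hε]
      exact Real.rpow_le_rpow_of_exponent_ge hε h1.le (by linarith)
    have e2 : 6 * (2 * ε ^ (1 - α₁) / C₀) = 12 / C₀ * ε ^ (1 - α₁) := by ring
    rw [e2]
    calc 12 / C₀ * ε ^ (1 - α₁) ≤ 12 / C₀ * (κ * C₀ / 12 * ε ^ (α₁ / α)) := by
          refine mul_le_mul_of_nonneg_left (e1.trans ?_) (by positivity)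
          gcongr
      _ = ρ := by rw [hρdef]; field_simp
  · have e1 : ε ^ (1 - α₁) * ε ^ α₁ = ε := by
      rw [← Real.rpow_add hε, sub_add_cancel, Real.rpow_one]
    rw [div_le_iff₀ (by positivity)]
    have e2 : 2 * C₀ * ε ^ α₁ * (2 * ε ^ (1 - α₁) / C₀) = 4 * (ε ^ (1 - α₁) * ε ^ α₁) := by
      field_simp
      norm_num
    rw [e2, e1]

section Sphere

variable {E H : Type*} [NormedAddCommGroup E] [InnerProductSpace ℝ E]
  [NormedAddCommGroup H] [InnerProductSpace ℝ H] {ι : E →L[ℝ] H} {μ : ℝ}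

/-- Points near an almost critical point outside `closure Q` stay outside `closure Q`. -/
theorem notMem_closure_of_almost_critical (hι : ‖ι‖ ≤ 1) (hμ : 0 < μ) {φ : E → ℝ}
    {α R L : ℝ} (hα0 : 0 < α) (hα1 : α ≤ 1) (hb : DerivBounds φ α R L) (hμL : μ⁻¹ ≤ L)
    {P Q : Set E} {V : E → E} {r m lam ρ : ℝ}
    (hsep : ∀ u ∈ P ∩ Metric.ball 0 R, ∀ v ∈ (massSphere ι μ ∩ Metric.ball 0 R) \ Q, r ≤ ‖u - v‖)
    (hV : ∀ u ∈ massSphere ι μ ∩ Metric.ball 0 R, ‖V u‖ ≤ ‖constrainedDeriv ι φ u‖)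
    (hm : ∀ u ∈ (Metric.ball 0 R ∩ closure Q) \ P, m ≤ ‖V u‖) (hρ1 : ρ ≤ 1) (hρr : ρ < r)
    (hlam : 4 * lam < m) (hρlam : 3 * L ^ 3 * ρ ^ α ≤ lam)
    {u : E} (hum : u ∈ massSphere ι μ) (hu : u ∈ Metric.ball 0 (R - 1)) (huQ : u ∉ closure Q)
    (hcrit : ‖constrainedDeriv ι φ u‖ ≤ 3 * lam) {v : E} (hvm : v ∈ massSphere ι μ)
    (hvu : ‖v - u‖ ≤ ρ) : v ∉ closure Q := by
  intro hvQ
  have huR : u ∈ Metric.ball 0 R := Metric.ball_subset_ball (by linarith) hu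
  have hv : v ∈ Metric.ball 0 R := by
    rw [mem_ball_zero_iff] at hu ⊢
    linarith [norm_le_norm_add_norm_sub' v u]
  by_cases hvP : v ∈ P
  · linarith [hsep v ⟨hvP, hv⟩ u ⟨⟨hum, huR⟩, fun h => huQ (subset_closure h)⟩]
  · linarith [hm v ⟨⟨hv, hvQ⟩, hvP⟩, hV v ⟨hvm, hv⟩,
      norm_constrainedDeriv_le_add hι hμ hα0 hα1 hb hμL hv hum huR hρ1 hvu]

end Sphere

end ConstrainedMinimax

/-! ### The contradiction with the minimax inequality. -/

theorem theorem6 {E H : Type*}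
    [NormedAddCommGroup E] [InnerProductSpace ℝ E] [CompleteSpace E]
    [NormedAddCommGroup H] [InnerProductSpace ℝ H] [CompleteSpace H]
    -- the Hilbert spaces `E ↪ H ↪ E'`
    (hEdim : ¬ FiniteDimensional ℝ E) (hHdim : ¬ FiniteDimensional ℝ H)
    (ι : E →L[ℝ] H) (hι_inj : Function.Injective ι) (hι_norm : ‖ι‖ ≤ 1)
    (hι_dual : Function.Injective fun h : H => (innerSL ℝ h).comp ι)
    (μ : ℝ) (hμ : 0 < μ)
    -- the functional
    (φ : E → ℝ) (hφ : ContDiff ℝ 2 φ)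
    (α : ℝ) (hα0 : 0 < α) (hα1 : α ≤ 1)
    (hHolder : ConstrainedMinimax.HolderDerivsOnBounded φ α)
    (heven : ∀ u ∈ ConstrainedMinimax.massSphere ι μ, φ (-u) = φ u)
    (R : ℝ) (hR : 1 < R)
    (α₁ : ℝ) (hα₁0 : 0 < α₁) (hα₁ : α₁ ≤ α / (2 * (α + 2)))
    -- `P = P*`, `Q = P**`; inside the ball, `P` keeps a positive distance from `S_μ` minus `Q`
    (P Q : Set E) (hPQ : P ⊆ Q)
    (hP : ConstrainedMinimax.IsSymmOpenIn ι μ P) (hQ : ConstrainedMinimax.IsSymmOpenIn ι μ Q)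
    (hsep : ∃ r : ℝ, 0 < r ∧ ∀ u ∈ P ∩ Metric.ball 0 R,
      ∀ v ∈ (ConstrainedMinimax.massSphere ι μ ∩ Metric.ball 0 R) \ Q, r ≤ ‖u - v‖)
    -- the pseudogradient
    (V : E → E) (hV : ConstrainedMinimax.IsPseudogradient ι μ φ V)
    (C₀ : ℝ) (hC₀0 : 0 < C₀) (hC₀1 : C₀ ≤ 1)
    (hVbound : ∀ u ∈ ConstrainedMinimax.massSphere ι μ ∩ Metric.ball 0 R,
      C₀ * ‖ConstrainedMinimax.constrainedDeriv ι φ u‖ ≤ ‖V u‖ ∧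
        ‖V u‖ ≤ ‖ConstrainedMinimax.constrainedDeriv ι φ u‖)
    -- conditions (A1) and (A2)
    (η : Set E → ℝ → ℝ → ℝ → ℝ → E → E)
    (hA1 : ConstrainedMinimax.FlowInvariance ι μ φ V P Q R η)
    (hA2 : ConstrainedMinimax.BoundedBelowOnCollar V P Q R)
    -- the minimax inequality
    (d : ℕ) (σ : EuclideanSpace ℝ (Fin d) → EuclideanSpace ℝ (Fin d))
    (hσ_isom : Isometry σ) (hσ_inv : Function.Involutive σ)
    (D : Set (EuclideanSpace ℝ (Fin d))) (hD : IsCompact D) (hσD : σ '' D = D)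
    (c : ℝ)
    (hc : ∀ (S : Set E) (ε ξ : ℝ), ConstrainedMinimax.IsDeformable ι μ φ V P Q R S c ε ξ →
      ∀ g : EuclideanSpace ℝ (Fin d) → E, ConstrainedMinimax.IsEquivariant ι μ σ D g →
        (c : EReal) ≤ ⨆ u ∈ (η S c ε ξ ξ '' (g '' D)) \ closure Q, (φ u : EReal)) :
    ∃ ε₀ : ℝ, 0 < ε₀ ∧ ∀ ε : ℝ, 0 < ε → ε < ε₀ →
      ∀ f : EuclideanSpace ℝ (Fin d) → E, ConstrainedMinimax.IsEquivariant ι μ σ D f →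
        (∀ u ∈ (f '' D) \ closure Q, φ u ≤ c + ε) →
        {u | u ∈ (f '' D) \ Q ∧ c - ε ≤ φ u} ⊆ Metric.ball 0 (R - 1) →
        ∃ u : E, ∀ v : E, v = u ∨ v = -u →
          v ∈ ConstrainedMinimax.massSphere ι μ ∧
          (c - ε ≤ φ v ∧ φ v ≤ c + ε) ∧
          ‖V v‖ ≤ 3 * ε ^ α₁ ∧
          v ∈ (f '' D) \ closure Q ∧
          ∀ W : Submodule ℝ E, W ≤ ConstrainedMinimax.tangentSpace ι v →
            (∀ w ∈ W, w ≠ 0 →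
              ConstrainedMinimax.constrainedHessian ι φ v w w < -ε ^ α₁ * ‖w‖ ^ 2) →
            Module.rank ℝ W ≤ d := by
  obtain ⟨r, hr, hsep⟩ := hsep
  obtain ⟨m, hm, hA2⟩ := hA2
  obtain ⟨L, hμL, hb⟩ := hHolder.exists_derivBounds hα0 (by linarith : 0 < R) μ⁻¹
  have hL := hb.one_le
  have hL0 : 0 < L := by linarith
  set N : ℝ := 2 * Besicovitch.multiplicity (EuclideanSpace ℝ (Fin d)) + 1 with hN
  have hN0 : 0 < N := by positivity
  obtain ⟨ε₀, hε₀, hscales⟩ := ConstrainedMinimax.exists_scales (A := 1000 * L ^ 40)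
    (B := 8 * L ^ 10 * N) hα0 hα₁0 hα₁ (by positivity) (by positivity) hC₀0 hr hm
  refine ⟨ε₀, hε₀, fun ε hε hεlt f hf hfc hfR => ?_⟩
  obtain ⟨ρ, δ, ξ, hδ, hξ, hρ2, hρr, hlamm, hρlam, hδρ, hδlam, hξρ, hεξ⟩ := hscales ε hε hεlt
  set lam : ℝ := ε ^ α₁ with hlamdef
  have hlam : 0 < lam := by positivity
  have hρ : 0 < ρ := by linarith
  have hρα : 0 ≤ ρ ^ α := by positivity
  have hρlam3 : 3 * L ^ 3 * ρ ^ α ≤ lam := by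
    have h1 : L ^ 3 ≤ L ^ 40 := pow_le_pow_right₀ hL (by norm_num)
    have h2 : 3 * L ^ 3 * ρ ^ α ≤ 1000 * L ^ 40 * ρ ^ α := by gcongr; norm_num
    linarith
  by_contra hcon
  obtain ⟨g, hg, hgx⟩ := ConstrainedMinimax.exists_deformation_below hι_norm hμ hφ heven hα0 hα1 hb
    hμL hσ_isom hσ_inv hD hσD hf hQ.symm hε hfc hfR hδ hρ2 (by rw [← hN]; linarith) hρlam hδlam
    (fun u hum hu huQ hcrit v hvm hvu =>
      ConstrainedMinimax.notMem_closure_of_almost_critical hι_norm hμ hα0 hα1 hb hμL hsep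
        (fun u hu => (hVbound u hu).2) hA2 (by linarith) hρr hlamm hρlam3 hum hu huQ hcrit hvm hvu)
    (fun x hx hxQ hlev hcrit => by
      -- The conclusion is required at both signs, so its failure yields a negative space at one of
      -- `f x`, `-f x = f (σ x)`.
      have hcon' := not_exists.1 hcon (f x)
      push Not at hcon'
      obtain ⟨v, hv, hnot⟩ := hcon'
      have hσx : σ x ∈ D := hσD ▸ mem_image_of_mem σ hx
      have hxm := hf.mapsTo hx
      have hxR : f x ∈ Metric.ball 0 (R - 1) :=
        hfR ⟨⟨mem_image_of_mem f hx, fun h => hxQ (subset_closure h)⟩, hlev⟩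
      have hxn := mem_ball_zero_iff.1 hxR
      have hup := hfc (f x) ⟨mem_image_of_mem f hx, hxQ⟩
      obtain ⟨y, hy, hyD, rfl, hyφ, hyc, hyQ, hyn⟩ : ∃ y, (y = x ∨ y = σ x) ∧ y ∈ D ∧ v = f y ∧
          φ (f y) = φ (f x) ∧ ‖ConstrainedMinimax.constrainedDeriv ι φ (f y)‖
            = ‖ConstrainedMinimax.constrainedDeriv ι φ (f x)‖ ∧ f y ∉ closure Q ∧
          ‖f y‖ = ‖f x‖ := by
        rcases hv with rfl | rfl
        · exact ⟨x, Or.inl rfl, hx, rfl, rfl, rfl, hxQ, rfl⟩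
        · refine ⟨σ x, Or.inr rfl, hσx, (hf.equivariant x hx).symm, ?_⟩
          rw [hf.equivariant x hx]
          exact ⟨heven _ hxm, ConstrainedMinimax.norm_constrainedDeriv_neg hμ
            (hφ.differentiable (by norm_num)) heven hxm,
            (ConstrainedMinimax.neg_mem_closure_iff hQ.symm _).not.2 hxQ, norm_neg _⟩
      have hVy := (hVbound (f y) ⟨hf.mapsTo hyD, mem_ball_zero_iff.2 (by linarith)⟩).2
      obtain ⟨W, hWT, hWneg, hWrank⟩ := hnot (hf.mapsTo hyD) ⟨by linarith, by linarith⟩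
        (by linarith) ⟨mem_image_of_mem f hyD, hyQ⟩
      obtain ⟨W', hW', hWdim⟩ := ConstrainedMinimax.exists_submodule_finrank_eq_succ hWrank.not_ge
      exact ⟨y, hy, W', hW'.trans hWT, hWdim, fun w hw hw0 => hWneg w (hW' hw) hw0⟩)
  -- The part of `g(D)` still to be lowered; its levels are at most `c + 2 * ε`, hence the
  -- deformation is taken with `2 * ε`.
  let S : Set E := {u | u ∈ (g '' D) \ closure Q ∧ c - ε / 2 ≤ φ u}
  have hgm : ∀ u ∈ g '' D, u ∈ ConstrainedMinimax.massSphere ι μ := by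
    rintro _ ⟨x, hx, rfl⟩
    exact hg.mapsTo hx
  have hSneg : ∀ u ∈ S, -u ∈ S := by
    rintro _ ⟨⟨⟨x, hx, rfl⟩, hxQ⟩, hlev⟩
    refine ⟨⟨⟨σ x, hσD ▸ mem_image_of_mem σ hx, hg.equivariant x hx⟩,
      (ConstrainedMinimax.neg_mem_closure_iff hQ.symm _).not.2 hxQ⟩, ?_⟩
    rwa [heven _ (hg.mapsTo hx)]
  have hSnear : ∀ v ∈ ConstrainedMinimax.nbhd ι μ S (2 * ξ), v ∈ Metric.ball 0 R ∧ v ∉ P ∧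
      2 * lam ≤ ‖ConstrainedMinimax.constrainedDeriv ι φ v‖ := by
    rintro v ⟨hvm, hvS⟩
    -- A closed neighbourhood need not contain a nearest point of `S`, hence the passage from `2 *
    -- ξ` to `3 * ξ ≤ ρ / 2`. The other `ρ / 2` is the distance from `g x` to `f x`.
    obtain ⟨_, ⟨⟨⟨x, hx, rfl⟩, hxQ⟩, hlev⟩, hvx⟩ := Metric.mem_thickening_iff.1
      (Metric.cthickening_subset_thickening' (δ₂ := 3 * ξ) (by linarith) (by linarith) S hvS)
    obtain ⟨hd, hrest⟩ := hgx x hx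
    obtain ⟨hfQ, -, hcrit⟩ := hrest hxQ
    obtain ⟨hfR', hfcrit⟩ := hcrit hlev
    have hvf : ‖v - f x‖ ≤ ρ := by
      rw [dist_eq_norm] at hvx
      have := norm_add_le (v - g x) (g x - f x)
      rw [sub_add_sub_cancel] at this
      linarith
    have hfn := mem_ball_zero_iff.1 hfR'
    have hfR2 : f x ∈ Metric.ball 0 R := mem_ball_zero_iff.2 (by linarith)
    have hvR : v ∈ Metric.ball 0 R :=
      mem_ball_zero_iff.2 (by linarith [norm_le_norm_add_norm_sub' v (f x)])
    refine ⟨hvR, fun hvP => ?_, ?_⟩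
    · linarith [hsep v ⟨hvP, hvR⟩ (f x)
        ⟨⟨hf.mapsTo hx, hfR2⟩, fun h => hfQ (subset_closure h)⟩]
    · rw [norm_sub_rev] at hvf
      linarith [ConstrainedMinimax.norm_constrainedDeriv_le_add hι_norm hμ hα0 hα1 hb hμL hfR2 hvm
        hvR (by linarith) hvf]
  have hdef : ConstrainedMinimax.IsDeformable ι μ φ V P Q R S c (2 * ε) ξ := by
    refine ⟨by positivity, hξ, fun u hu => ⟨hgm u hu.1.1, hu.1.2⟩,
      fun u => ⟨fun hu => neg_neg u ▸ hSneg _ hu, hSneg u⟩,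
      fun v hv => ⟨(hSnear v hv).1, (hSnear v hv).2.1⟩, fun v hv _ => ?_⟩
    obtain ⟨h1, -, h2⟩ := hSnear v hv.2
    have h3 := (hVbound v ⟨hv.2.1, h1⟩).1
    have h4 := mul_le_mul_of_nonneg_left h2 hC₀0.le
    have h5 : 2 * (2 * ε) / ξ = 4 * ε / ξ := by ring
    rw [h5]
    linarith
  have hη := hA1 S c (2 * ε) ξ hdef
  have hsup := hc S (2 * ε) ξ hdef g hg
  -- Points of `g(D)` below `c - ε / 2` do not rise under the deformation; those of `S` drop to `c -
  -- 2 * ε` or enter `closure Q`, and points of `closure Q` stay there.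
  have hle : (⨆ u ∈ (η S c (2 * ε) ξ ξ '' (g '' D)) \ closure Q, (φ u : EReal))
      ≤ ((c - ε / 2 : ℝ) : EReal) := by
    refine iSup₂_le fun u hu => ?_
    obtain ⟨⟨_, ⟨x, hx, rfl⟩, rfl⟩, huQ⟩ := hu
    have hξmem : ξ ∈ Icc 0 ξ := ⟨hξ.le, le_rfl⟩
    have hxQ : g x ∉ closure Q := fun h => huQ (hη.invariant ξ hξmem _ h)
    obtain ⟨-, hup, -⟩ := (hgx x hx).2 hxQ
    rw [EReal.coe_le_coe_iff]
    rcases lt_or_ge (φ (g x)) (c - ε / 2) with hlow | hhigh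
    · have := hη.antitone _ (hg.mapsTo hx) ⟨le_rfl, hξ.le⟩ hξmem hξ.le
      simp only [hη.zero _ (hg.mapsTo hx)] at this
      linarith
    · have := (hη.descend (g x) ⟨⟨mem_image_of_mem g hx, hxQ⟩, hhigh⟩ hup).resolve_left huQ
      linarith
  have := EReal.coe_le_coe_iff.1 (hsup.trans hle)
  linarith
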